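/- Let $A$ be an associative, not necessarily unital ring, and let $R$ be a unital ring containing $A$ as a two-sided ideal (for instance $R=\tilde A=\mathbb Z\ltimes A$, the ring obtained from $A$ by adjoining an identity; in that case left $R$-modules are the same as left $A$-modules and $R/A=\mathbb Z$). A left $R$-module $M$ is called h-unitary if $\operatorname{Tor}_n^R(R/A,M)=0$ for all $n\ge 0$; let $\mathfrak M(A)$ be the full subcategory of $R$-$\mathrm{Mod}$ consisting of the h-unitary modules. For $M,N\in\mathfrak M(A)$ let $\operatorname{Ext}^1_{\mathfrak M(A)}(M,N)$ be the relative extension group formed by the congruence classes of short exact sequences $0\to N\to X\to M\to 0$ of $R$-modules with $X\in\mathfrak M(A)$; orthogonals, cotorsion pairs and exact sequences in $\mathfrak M(A)$ below refer to this relative structure. Let $\mathcal F$ be the class of h-unitary modules that are flat over $R$, and let $$\mathcal C=\{C\in\mathfrak M(A):\operatorname{Ext}^1_{\mathfrak M(A)}(F,C)=0\ \text{ for all } F\in\mathcal F\}$$ be the class of h-unitary cotorsion modules. (1) $(\mathcal F,\mathcal C)$ is a complete cotorsion pair in $\mathfrak M(A)$. That is, within $\mathfrak M(A)$ one has $\mathcal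 F^{\perp}=\mathcal C$ and ${}^{\perp}\mathcal C=\mathcal F$; for every $Y\in\mathfrak M(A)$ there is an exact sequence $0\to Y\to C\to F\to 0$ with $C\in\mathcal C$ and $F\in\mathcal F$; and for every $Z\in\mathfrak M(A)$ there is an exact sequence $0\to C'\to F'\to Z\to 0$ with $C'\in\mathcal C$ and $F'\in\mathcal F$. (2) Let $\aleph$ be any cardinal with $\aleph\ge\max\{|A|,\aleph_0\}$, and let $\mathcal S_\aleph$ be the class of all modules in $\mathcal F$ of cardinality at most $\aleph$. Up to isomorphism $\mathcal S_\aleph$ is a set. Every $F\in\mathcal F$ is $\mathcal S_\aleph$-filtered: there are an ordinal $\lambda$ and submodules $(F_\alpha)_{\alpha\le\lambda}$ of $F$ with $F_0=0$, $F_\lambda=F$, $F_\alpha\subseteq F_{\alpha+1}$ and $F_{\alpha+1}/F_\alpha\in\mathcal S_\aleph$ for all $\alpha<\lambda$, and $F_\beta=\bigcup_{\alpha<\beta}F_\alpha$ for all limit ordinals $\beta\le\lambda$. Moreover $\mathcal S_\aleph$ cogenerates the pair $(\mathcal F,\mathcal C)$ in $\mathfrak M(A)$: $\mathcal S_\aleph\subseteq\mathcal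 F$ and $\mathcal S_\aleph^{\perp}=\mathcal F^{\perp}=\mathcal C$. -/

import Mathlib

open CategoryTheory
open scoped TensorProduct Cardinal

universe u

/-! ### Tensor products, flatness and `Tor` over a noncommutative ring

Left `R`-modules are modules over `R`; right `R`-modules are modules over `Rᵐᵒᵖ`, with
`x r` written `MulOpposite.op r • x`. -/

section Tensor

variable {R : Type u} [Ring R]

/-- The subgroup of `X ⊗_ℤ M` generated by the elements `x r ⊗ m - x ⊗ r m`. -/
def balancedRelations (R : Type u) [Ring R] (X : Type u) [AddCommGroup X] [Module Rᵐᵒᵖ X]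
    (M : Type u) [AddCommGroup M] [Module R M] : AddSubgroup (X ⊗[ℤ] M) :=
  AddSubgroup.closure
    {t | ∃ (x : X) (r : R) (m : M), t = (MulOpposite.op r • x) ⊗ₜ[ℤ] m - x ⊗ₜ[ℤ] (r • m)}

/-- The tensor product `X ⊗_R M` of a right `R`-module `X` and a left `R`-module `M`. -/
abbrev BalancedTensor (R : Type u) [Ring R] (X : Type u) [AddCommGroup X] [Module Rᵐᵒᵖ X]
    (M : Type u) [AddCommGroup M] [Module R M] : Type u :=
  (X ⊗[ℤ] M) ⧸ balancedRelations R X M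

/-- The map `f ⊗_R M : X ⊗_R M → Y ⊗_R M` induced by a homomorphism `f : X → Y` of right
`R`-modules. -/
def balancedMap {X Y : Type u} [AddCommGroup X] [Module Rᵐᵒᵖ X] [AddCommGroup Y] [Module Rᵐᵒᵖ Y]
    (f : X →ₗ[Rᵐᵒᵖ] Y) (M : Type u) [AddCommGroup M] [Module R M] :
    BalancedTensor R X M →+ BalancedTensor R Y M :=
  QuotientAddGroup.map _ _
    (TensorProduct.map f.toAddMonoidHom.toIntLinearMap LinearMap.id).toAddMonoidHom <| by
    rw [balancedRelations, AddSubgroup.closure_le]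
    rintro _ ⟨x, r, m, rfl⟩
    refine AddSubgroup.subset_closure ⟨f x, r, m, ?_⟩
    rw [map_sub]
    exact congrArg (fun y => y ⊗ₜ[ℤ] m - f x ⊗ₜ[ℤ] (r • m)) (map_smul f (MulOpposite.op r) x)

/-- Homomorphisms out of `X ⊗_R M` that agree on elementary tensors are equal. -/
theorem balancedTensor_hom_ext {X M B : Type u} [AddCommGroup X] [Module Rᵐᵒᵖ X]
    [AddCommGroup M] [Module R M] [AddCommGroup B] {φ ψ : BalancedTensor R X M →+ B}
    (h : ∀ (x : X) (m : M), φ (QuotientAddGroup.mk (x ⊗ₜ[ℤ] m))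
      = ψ (QuotientAddGroup.mk (x ⊗ₜ[ℤ] m))) : φ = ψ := by
  refine QuotientAddGroup.addMonoidHom_ext _ (DFunLike.ext _ _ fun t => ?_)
  induction t with
  | zero => rw [map_zero, map_zero]
  | tmul x m => exact h x m
  | add s t hs ht => rw [map_add, map_add, hs, ht]

/-- The functor `- ⊗_R M` from right `R`-modules to abelian groups. -/
def tensorFunctor (M : ModuleCat.{u} R) : ModuleCat.{u} Rᵐᵒᵖ ⥤ AddCommGrpCat.{u} where
  obj X := AddCommGrpCat.of (BalancedTensor R X M)
  map f := AddCommGrpCat.ofHom (balancedMap f.hom M)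
  map_id _ := AddCommGrpCat.hom_ext (balancedTensor_hom_ext fun _ _ => rfl)
  map_comp _ _ := AddCommGrpCat.hom_ext (balancedTensor_hom_ext fun _ _ => rfl)

instance (M : ModuleCat.{u} R) : (tensorFunctor M).Additive where
  map_add {_ _ f g} := AddCommGrpCat.hom_ext (balancedTensor_hom_ext fun x m =>
    congrArg QuotientAddGroup.mk (TensorProduct.add_tmul (f.hom x) (g.hom x) m))

/-- `Tor_n^R(X, M)` for a right `R`-module `X` and a left `R`-module `M`: the `n`-th left derived
functor of `- ⊗_R M`, evaluated at `X`. -/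
noncomputable def torObj (n : ℕ) (X : ModuleCat.{u} Rᵐᵒᵖ) (M : ModuleCat.{u} R) :
    AddCommGrpCat.{u} :=
  ((tensorFunctor M).leftDerived n).obj X

/-- A left `R`-module `M` is flat if `- ⊗_R M` preserves injectivity of homomorphisms of right
`R`-modules. -/
def IsFlatModule (M : ModuleCat.{u} R) : Prop :=
  ∀ (X Y : ModuleCat.{u} Rᵐᵒᵖ) (f : X ⟶ Y),
    Function.Injective f.hom → Function.Injective (balancedMap f.hom M)

end Tensor

/-! ### Nonunital rings and their unital extension rings -/

/-- An embedding of the nonunital ring `A` as a two-sided ideal of the unital ring `R`. -/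
structure UnitalExtension (A : Type u) [NonUnitalRing A] (R : Type u) [Ring R] where
  /-- the embedding -/
  toHom : A →ₙ+* R
  injective : Function.Injective toHom
  mul_left_mem : ∀ (r : R) (a : A), r * toHom a ∈ Set.range toHom
  mul_right_mem : ∀ (a : A) (r : R), toHom a * r ∈ Set.range toHom

/-- The embedding of `A` in `ℤ ⋉ A`, the unital ring obtained from `A` by adjoining an
identity. -/
def UnitalExtension.standard (A : Type u) [NonUnitalRing A] :
    UnitalExtension A (Unitization ℤ A) where
  toHom := (Unitization.inrNonUnitalAlgHom ℤ A : A →ₙ+* Unitization ℤ A)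
  injective := Unitization.inr_injective
  mul_left_mem r a := by
    change r * (a : Unitization ℤ A) ∈ Set.range (Unitization.inr : A → Unitization ℤ A)
    exact ⟨r.fst • a + r.snd * a, by ext <;> simp [-zsmul_eq_mul]⟩
  mul_right_mem a r := by
    change (a : Unitization ℤ A) * r ∈ Set.range (Unitization.inr : A → Unitization ℤ A)
    exact ⟨r.fst • a + a * r.snd, by ext <;> simp [-zsmul_eq_mul]⟩

section HUnitary

variable {A : Type u} [NonUnitalRing A] {R : Type u} [Ring R]

/-- The two-sided ideal `A` of `R`, as a submodule of the right `R`-module `R`. -/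
def UnitalExtension.rightIdeal (E : UnitalExtension A R) : Submodule Rᵐᵒᵖ R where
  carrier := Set.range E.toHom
  zero_mem' := ⟨0, map_zero _⟩
  add_mem' := by
    rintro _ _ ⟨a, rfl⟩ ⟨b, rfl⟩
    exact ⟨a + b, map_add _ _ _⟩
  smul_mem' := by
    rintro r _ ⟨a, rfl⟩
    exact E.mul_right_mem a r.unop

/-- The right `R`-module `R / A`; for `R = ℤ ⋉ A` this is `ℤ` with `A` acting as zero. -/
def UnitalExtension.quotient (E : UnitalExtension A R) : ModuleCat.{u} Rᵐᵒᵖ :=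
  ModuleCat.of Rᵐᵒᵖ (R ⧸ E.rightIdeal)

/-- `M` is h-unitary if `Tor_n^R(R / A, M) = 0` for all `n ≥ 0`. The full subcategory of left
`R`-modules on these objects is `𝔐(A)`. -/
def HUnitary (E : UnitalExtension A R) : ObjectProperty (ModuleCat.{u} R) :=
  fun M => ∀ n : ℕ, Limits.IsZero (torObj n E.quotient M)

end HUnitary

/-! ### Relative `Ext¹` and cotorsion pairs in a full subcategory of `R`-modules

`P` is a full subcategory of left `R`-modules, and the proper exact sequences in `P` are the short
exact sequences of `R`-modules all of whose terms lie in `P`. -/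

section Relative

variable {R : Type u} [Ring R]

/-- An extension `0 ⟶ N ⟶ X ⟶ M ⟶ 0` with middle term in `P`. -/
structure ProperExtension (P : ObjectProperty (ModuleCat.{u} R)) (M N : ModuleCat.{u} R) where
  X : ModuleCat.{u} R
  mem : P X
  i : N ⟶ X
  p : X ⟶ M
  w : i ≫ p = 0
  shortExact : (ShortComplex.mk i p w).ShortExact

/-- Congruence of extensions: an isomorphism of the middle terms which is the identity on both
ends. -/
def properExtensionSetoid (P : ObjectProperty (ModuleCat.{u} R)) (M N : ModuleCat.{u} R) :
    Setoid (ProperExtension P M N) where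
  r ξ η := ∃ e : ξ.X ≅ η.X, ξ.i ≫ e.hom = η.i ∧ e.hom ≫ η.p = ξ.p
  iseqv :=
    { refl := fun ξ => ⟨Iso.refl _, by simp, by simp⟩
      symm := by
        rintro ξ η ⟨e, h₁, h₂⟩
        exact ⟨e.symm, by simp [← h₁], by simp [← h₂]⟩
      trans := by
        rintro ξ η ζ ⟨e, h₁, h₂⟩ ⟨f, h₃, h₄⟩
        exact ⟨e ≪≫ f, by simp [reassoc_of% h₁, h₃], by simp [h₄, h₂]⟩ }

/-- `Ext¹_P(M, N)`: congruence classes of extensions of `M` by `N` in `P`. -/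
def RelExt1 (P : ObjectProperty (ModuleCat.{u} R)) (M N : ModuleCat.{u} R) : Type (u + 1) :=
  Quotient (properExtensionSetoid P M N)

/-- `Ext¹_P(M, N) = 0`: the class of the split extension is the only one. -/
def RelExt1Vanishes (P : ObjectProperty (ModuleCat.{u} R)) (M N : ModuleCat.{u} R) : Prop :=
  Subsingleton (RelExt1 P M N)

/-- `𝒟^⊥` in `P`. -/
def rightOrth (P 𝒟 : ObjectProperty (ModuleCat.{u} R)) : ObjectProperty (ModuleCat.{u} R) :=
  fun Y => P Y ∧ ∀ D, 𝒟 D → RelExt1Vanishes P D Y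

/-- `^⊥𝒟` in `P`. -/
def leftOrth (P 𝒟 : ObjectProperty (ModuleCat.{u} R)) : ObjectProperty (ModuleCat.{u} R) :=
  fun Z => P Z ∧ ∀ D, 𝒟 D → RelExt1Vanishes P Z D

/-- `(ℱ, 𝒞)` is a cotorsion pair in `P`: `ℱ^⊥ = 𝒞` and `^⊥𝒞 = ℱ`. -/
def IsCotorsionPair (P ℱ 𝒞 : ObjectProperty (ModuleCat.{u} R)) : Prop :=
  rightOrth P ℱ = 𝒞 ∧ leftOrth P 𝒞 = ℱ

/-- Every `Y` in `P` has an exact sequence `0 ⟶ Y ⟶ C ⟶ F ⟶ 0` with `F` in `ℱ`, `C` in `𝒞`. -/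
def HasEnoughInjectives (P ℱ 𝒞 : ObjectProperty (ModuleCat.{u} R)) : Prop :=
  ∀ Y, P Y → ∃ (C F : ModuleCat.{u} R) (i : Y ⟶ C) (p : C ⟶ F) (w : i ≫ p = 0),
    𝒞 C ∧ ℱ F ∧ (ShortComplex.mk i p w).ShortExact

/-- Every `Z` in `P` has an exact sequence `0 ⟶ C ⟶ F ⟶ Z ⟶ 0` with `F` in `ℱ`, `C` in `𝒞`. -/
def HasEnoughProjectives (P ℱ 𝒞 : ObjectProperty (ModuleCat.{u} R)) : Prop :=
  ∀ Z, P Z → ∃ (C F : ModuleCat.{u} R) (i : C ⟶ F) (p : F ⟶ Z) (w : i ≫ p = 0),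
    𝒞 C ∧ ℱ F ∧ (ShortComplex.mk i p w).ShortExact

/-- A complete cotorsion pair in `P`. -/
def IsCompleteCotorsionPair (P ℱ 𝒞 : ObjectProperty (ModuleCat.{u} R)) : Prop :=
  IsCotorsionPair P ℱ 𝒞 ∧ HasEnoughInjectives P ℱ 𝒞 ∧ HasEnoughProjectives P ℱ 𝒞

/-- `𝒮 ⊆ ℱ` cogenerates the pair `(ℱ, ℱ^⊥)` in `P`: `𝒮^⊥ = ℱ^⊥`. -/
def Cogenerates (P 𝒮 ℱ : ObjectProperty (ModuleCat.{u} R)) : Prop :=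
  𝒮 ≤ ℱ ∧ rightOrth P 𝒮 = rightOrth P ℱ

/-- `M` is `𝓛`-filtered: it is the union of a continuous well-ordered chain of submodules
`(X_α | α ≤ l)` with `X_0 = 0`, `X_l = M` and `X_{α+1} / X_α` in `𝓛` whenever `α + 1 ≤ l`. -/
def IsFilteredBy (𝓛 : ObjectProperty (ModuleCat.{u} R)) (M : ModuleCat.{u} R) : Prop :=
  ∃ (l : Ordinal.{u}) (X : Ordinal.{u} → Submodule R M),
    X 0 = ⊥ ∧ X l = ⊤ ∧
    (∀ α, α < l → X α ≤ X (Order.succ α)) ∧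
    (∀ β, β ≤ l → Order.IsSuccLimit β → X β = ⨆ α : Set.Iio β, X α) ∧
    (∀ α, α < l → 𝓛 (ModuleCat.of R (X (Order.succ α) ⧸ (X α).submoduleOf (X (Order.succ α)))))

end Relative

section Classes

variable {A : Type u} [NonUnitalRing A] {R : Type u} [Ring R]

/-- The class of h-unitary flat modules. -/
def HUnitaryFlat (E : UnitalExtension A R) : ObjectProperty (ModuleCat.{u} R) :=
  fun M => HUnitary E M ∧ IsFlatModule M

/-- The class of h-unitary cotorsion modules. -/
def HUnitaryCotorsion (E : UnitalExtension A R) : ObjectProperty (ModuleCat.{u} R) :=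
  fun C => HUnitary E C ∧ ∀ F, HUnitaryFlat E F → RelExt1Vanishes (HUnitary E) F C

/-- The class of h-unitary flat modules of cardinality at most `κ`. -/
def SmallHUnitaryFlat (E : UnitalExtension A R) (κ : Cardinal.{u}) :
    ObjectProperty (ModuleCat.{u} R) :=
  fun M => HUnitaryFlat E M ∧ #M ≤ κ

end Classes

/-! ### Exactness of the balanced tensor product. -/

section TensorTools

variable {R : Type u} [Ring R]

/-! A flat module is h-unitary as soon as `M = A M` (`hUnitaryFlat_iff`): tensoring a projective
resolution of `R / A` with a flat module keeps it exact, so the only obstruction sits in degree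
zero. The class `ℱ` is therefore cut out by the equational criterion of flatness and the condition
`M = A M`.

If `M = A M`, the equations that control a submodule can be rewritten with coefficients in `A`,
because `r a ∈ A`. Closing a small subset under solutions of such equations yields small submodules
`S = A S` with `S` and `M / S` flat (`exists_small_pure_submodule`); the size of `R` plays no role.
Transfinite iteration of this step gives the filtrations, and the same step in a Zorn argument gives
Eklof's lemma (`extensionsSplit_of_rightOrth_small`), so a set of modules detects `𝒞`.

Completeness comes from the small object argument for inclusions `K ⊆ L` with `L` free and `L / K`
running through representatives of the small members of `ℱ` (`exists_factorization`). Factoring `Y →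
0` gives the sequence starting at `Y`. Factoring `0 → Z`, after adjoining `0 ⊆ F₀` for some `F₀` in
`ℱ` mapping onto `Z` (`IsUnitaryModule.exists_flat_surjection`), gives the one ending at `Z`. The
h-unitary modules are closed under extensions and kernels of surjections, so all terms stay
h-unitary, and vanishing of the relative `Ext¹` means that every extension of `R`-modules splits. -/

/-- The elementary tensor `x ⊗ m` in `X ⊗_R M`. -/
def btmul (R : Type u) [Ring R] {X M : Type u} [AddCommGroup X] [Module Rᵐᵒᵖ X]
    [AddCommGroup M] [Module R M] (x : X) (m : M) : BalancedTensor R X M :=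
  QuotientAddGroup.mk (x ⊗ₜ[ℤ] m)

variable {X Y Z : Type u} [AddCommGroup X] [Module Rᵐᵒᵖ X] [AddCommGroup Y] [Module Rᵐᵒᵖ Y]
  [AddCommGroup Z] [Module Rᵐᵒᵖ Z]
variable {M N L : Type u} [AddCommGroup M] [Module R M] [AddCommGroup N] [Module R N]
  [AddCommGroup L] [Module R L]
variable {B : Type u} [AddCommGroup B]

theorem btmul_add (x : X) (m m' : M) : btmul R x (m + m') = btmul R x m + btmul R x m' :=
  congrArg QuotientAddGroup.mk (TensorProduct.tmul_add x m m')

theorem add_btmul (x x' : X) (m : M) : btmul R (x + x') m = btmul R x m + btmul R x' m :=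
  congrArg QuotientAddGroup.mk (TensorProduct.add_tmul x x' m)

theorem btmul_zero (x : X) : btmul R x (0 : M) = 0 :=
  congrArg QuotientAddGroup.mk (TensorProduct.tmul_zero M x)

theorem zero_btmul (m : M) : btmul R (0 : X) m = 0 :=
  congrArg QuotientAddGroup.mk (TensorProduct.zero_tmul X m)

theorem smul_btmul (r : R) (x : X) (m : M) :
    btmul R (MulOpposite.op r • x) m = btmul R x (r • m) := by
  rw [← sub_eq_zero]
  exact (QuotientAddGroup.eq_zero_iff _).2 (AddSubgroup.subset_closure ⟨x, r, m, rfl⟩)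

theorem sum_btmul {ι : Type*} (s : Finset ι) (x : ι → X) (m : M) :
    btmul R (∑ i ∈ s, x i) m = ∑ i ∈ s, btmul R (x i) m := by
  classical
  induction s using Finset.induction_on with
  | empty => simp [zero_btmul]
  | insert i s hi ih => rw [Finset.sum_insert hi, Finset.sum_insert hi, add_btmul, ih]

theorem btmul_sum {ι : Type*} (s : Finset ι) (x : X) (m : ι → M) :
    btmul R x (∑ i ∈ s, m i) = ∑ i ∈ s, btmul R x (m i) := by
  classical
  induction s using Finset.induction_on with
  | empty => simp [btmul_zero]
  | insert i s hi ih => rw [Finset.sum_insert hi, Finset.sum_insert hi, btmul_add, ih]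

theorem balancedTensor_induction {p : BalancedTensor R X M → Prop} (t : BalancedTensor R X M)
    (zero : p 0) (tmul : ∀ x m, p (btmul R x m)) (add : ∀ s t, p s → p t → p (s + t)) : p t := by
  induction t using QuotientAddGroup.induction_on with
  | H t =>
    induction t with
    | zero => exact zero
    | tmul x m => exact tmul x m
    | add s t hs ht => exact add _ _ hs ht

/-- A balanced biadditive map `X → M → B` induces a map on `X ⊗_R M`. -/
def balancedLift (f : X →+ M →+ B)
    (hf : ∀ (x : X) (r : R) (m : M), f (MulOpposite.op r • x) m = f x (r • m)) :
    BalancedTensor R X M →+ B :=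
  QuotientAddGroup.lift _ (TensorProduct.liftAddHom f fun n x m => by simp) <| by
    rw [balancedRelations, AddSubgroup.closure_le]
    rintro _ ⟨x, r, m, rfl⟩
    simp [hf x r m]

@[simp]
theorem balancedLift_btmul (f : X →+ M →+ B)
    (hf : ∀ (x : X) (r : R) (m : M), f (MulOpposite.op r • x) m = f x (r • m)) (x : X) (m : M) :
    balancedLift f hf (btmul R x m) = f x m := rfl

@[simp]
theorem balancedMap_btmul (f : X →ₗ[Rᵐᵒᵖ] Y) (x : X) (m : M) :
    balancedMap f M (btmul R x m) = btmul R (f x) m := rfl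

/-- The map `X ⊗_R g : X ⊗_R M → X ⊗_R N` induced by `g : M → N`. -/
def balancedMapRight (X : Type u) [AddCommGroup X] [Module Rᵐᵒᵖ X] (g : M →ₗ[R] N) :
    BalancedTensor R X M →+ BalancedTensor R X N :=
  balancedLift
    (AddMonoidHom.mk' (fun x => AddMonoidHom.mk' (fun m => btmul R x (g m)) fun m m' => by
      rw [map_add, btmul_add]) fun x x' => AddMonoidHom.ext fun m => add_btmul x x' (g m))
    fun x r m => by
      change btmul R _ (g m) = btmul R x (g (r • m))
      rw [smul_btmul, map_smul]

/-- Homomorphisms out of `X ⊗_R M` that agree on elementary tensors agree everywhere. -/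
theorem balancedTensor_hom_congr {B : Type*} [AddCommGroup B] (φ ψ : BalancedTensor R X M →+ B)
    (h : ∀ (x : X) (m : M), φ (btmul R x m) = ψ (btmul R x m)) (t : BalancedTensor R X M) :
    φ t = ψ t := by
  induction t using balancedTensor_induction with
  | zero => rw [map_zero, map_zero]
  | tmul x m => exact h x m
  | add s t hs ht => rw [map_add, map_add, hs, ht]

theorem balancedMap_comp_apply (f : X →ₗ[Rᵐᵒᵖ] Y) (g : Y →ₗ[Rᵐᵒᵖ] Z)
    (t : BalancedTensor R X M) :
    balancedMap g M (balancedMap f M t) = balancedMap (g ∘ₗ f) M t :=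
  balancedTensor_hom_congr ((balancedMap g M).comp (balancedMap f M)) (balancedMap (g ∘ₗ f) M)
    (fun _ _ => rfl) t

theorem balancedMapRight_comp_apply (f : M →ₗ[R] N) (g : N →ₗ[R] L)
    (t : BalancedTensor R X M) :
    balancedMapRight X g (balancedMapRight X f t) = balancedMapRight X (g ∘ₗ f) t :=
  balancedTensor_hom_congr ((balancedMapRight X g).comp (balancedMapRight X f))
    (balancedMapRight X (g ∘ₗ f)) (fun _ _ => rfl) t

theorem balancedMap_balancedMapRight (f : X →ₗ[Rᵐᵒᵖ] Y) (g : M →ₗ[R] N)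
    (t : BalancedTensor R X M) :
    balancedMap f N (balancedMapRight X g t) = balancedMapRight Y g (balancedMap f M t) :=
  balancedTensor_hom_congr ((balancedMap f N).comp (balancedMapRight X g))
    ((balancedMapRight Y g).comp (balancedMap f M)) (fun _ _ => rfl) t

theorem balancedMapRight_zero (t : BalancedTensor R X M) :
    balancedMapRight X (0 : M →ₗ[R] N) t = 0 :=
  balancedTensor_hom_congr (balancedMapRight X (0 : M →ₗ[R] N)) 0 (fun x _ => btmul_zero x) t

theorem balancedMap_zero (t : BalancedTensor R X M) :
    balancedMap (0 : X →ₗ[Rᵐᵒᵖ] Y) M t = 0 :=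
  balancedTensor_hom_congr (balancedMap (0 : X →ₗ[Rᵐᵒᵖ] Y) M) 0 (fun _ m => zero_btmul m) t

theorem balancedMap_surjective {f : X →ₗ[Rᵐᵒᵖ] Y} (hf : Function.Surjective f) :
    Function.Surjective (balancedMap f M) := by
  intro t
  induction t using balancedTensor_induction with
  | zero => exact ⟨0, map_zero _⟩
  | tmul y m =>
    obtain ⟨x, rfl⟩ := hf y
    exact ⟨btmul R x m, rfl⟩
  | add s t hs ht =>
    obtain ⟨s, rfl⟩ := hs
    obtain ⟨t, rfl⟩ := ht
    exact ⟨s + t, map_add _ _ _⟩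

theorem balancedMapRight_surjective {g : M →ₗ[R] N} (hg : Function.Surjective g) :
    Function.Surjective (balancedMapRight X g) := by
  intro t
  induction t using balancedTensor_induction with
  | zero => exact ⟨0, map_zero _⟩
  | tmul x n =>
    obtain ⟨m, rfl⟩ := hg n
    exact ⟨btmul R x m, rfl⟩
  | add s t hs ht =>
    obtain ⟨s, rfl⟩ := hs
    obtain ⟨t, rfl⟩ := ht
    exact ⟨s + t, map_add _ _ _⟩

/-! ### Character modules -/

/-- The character module of a left module is a right module. -/
instance charModuleRight : Module Rᵐᵒᵖ (CharacterModule M) where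
  smul r c := AddMonoidHom.comp c (DistribSMul.toAddMonoidHom M r.unop)
  one_smul c := DFunLike.ext _ _ fun m => congrArg c (one_smul R m)
  mul_smul r s c := DFunLike.ext _ _ fun m => congrArg c (mul_smul s.unop r.unop m)
  smul_zero _ := rfl
  smul_add _ _ _ := rfl
  add_smul r s c := DFunLike.ext _ _ fun m =>
    (congrArg c (add_smul r.unop s.unop m)).trans (map_add c _ _)
  zero_smul c := DFunLike.ext _ _ fun m => (congrArg c (zero_smul R m)).trans (map_zero c)

/-- The character module of a right module is a left module. -/
instance charModuleLeft : Module R (CharacterModule X) where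
  smul r c := AddMonoidHom.comp c (DistribSMul.toAddMonoidHom X (MulOpposite.op r))
  one_smul c := DFunLike.ext _ _ fun m => congrArg c (one_smul Rᵐᵒᵖ m)
  mul_smul r s c := DFunLike.ext _ _ fun m =>
    congrArg c (mul_smul (MulOpposite.op s) (MulOpposite.op r) m)
  smul_zero _ := rfl
  smul_add _ _ _ := rfl
  add_smul r s c := DFunLike.ext _ _ fun m =>
    (congrArg c (add_smul (MulOpposite.op r) (MulOpposite.op s) m)).trans (map_add c _ _)
  zero_smul c := DFunLike.ext _ _ fun m => (congrArg c (zero_smul Rᵐᵒᵖ m)).trans (map_zero c)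

theorem charRight_smul_apply (r : Rᵐᵒᵖ) (c : CharacterModule M) (m : M) :
    (r • c) m = c (r.unop • m) := rfl

/-- A subgroup is an intersection of kernels of characters. -/
theorem exists_char_separating {G : Type u} [AddCommGroup G] (H : AddSubgroup G) {t : G}
    (ht : t ∉ H) : ∃ c : CharacterModule G, (∀ h ∈ H, c h = 0) ∧ c t ≠ 0 := by
  obtain ⟨c, hc⟩ := CharacterModule.exists_character_apply_ne_zero_of_ne_zero
    (a := (QuotientAddGroup.mk t : G ⧸ H)) (fun h => ht ((QuotientAddGroup.eq_zero_iff t).1 h))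
  refine ⟨AddMonoidHom.comp c (QuotientAddGroup.mk' H), fun h hh => ?_, hc⟩
  exact (congrArg c ((QuotientAddGroup.eq_zero_iff h).2 hh)).trans (map_zero c)

/-- The character of `X ⊗_R M` given by `φ : X → M*`. -/
def charOfRight (φ : X →ₗ[Rᵐᵒᵖ] CharacterModule M) : CharacterModule (BalancedTensor R X M) :=
  QuotientAddGroup.lift _ (TensorProduct.liftAddHom
    (AddMonoidHom.mk' (fun x => (φ x : M →+ AddCircle (1 : ℚ))) fun x y => map_add φ x y)
    fun n x m => by
      change φ (n • x) m = φ x (n • m)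
      rw [map_zsmul, map_zsmul]; rfl) <| by
    rw [balancedRelations, AddSubgroup.closure_le]
    rintro _ ⟨x, r, m, rfl⟩
    rw [SetLike.mem_coe, AddMonoidHom.mem_ker, map_sub, sub_eq_zero]
    change φ (MulOpposite.op r • x) m = φ x (r • m)
    rw [map_smul]; rfl

/-- The map `X → M*` given by a character of `X ⊗_R M`. -/
def curryRight (c : CharacterModule (BalancedTensor R X M)) : X →ₗ[Rᵐᵒᵖ] CharacterModule M where
  toFun x := AddMonoidHom.mk' (fun m => c (btmul R x m)) fun m m' => by rw [btmul_add, map_add]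
  map_add' x y := DFunLike.ext _ _ fun m =>
    (congrArg c (add_btmul x y m)).trans (map_add c _ _)
  map_smul' r x := DFunLike.ext _ _ fun m => congrArg c (smul_btmul r.unop x m)

/-- Transposition `Hom_R(M, X*) → Hom_R(X, M*)`. -/
def transposeRight (φ : M →ₗ[R] CharacterModule X) : X →ₗ[Rᵐᵒᵖ] CharacterModule M where
  toFun x := AddMonoidHom.mk' (fun m => φ m x) fun m m' => by rw [map_add]; rfl
  map_add' x y := DFunLike.ext _ _ fun m => map_add (φ m) x y
  map_smul' r x := DFunLike.ext _ _ fun m => by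
    exact (DFunLike.congr_fun (map_smul φ r.unop m) x).symm

/-- Transposition `Hom_R(X, M*) → Hom_R(M, X*)`. -/
def transposeLeft (φ : X →ₗ[Rᵐᵒᵖ] CharacterModule M) : M →ₗ[R] CharacterModule X where
  toFun m := AddMonoidHom.mk' (fun x => φ x m) fun x x' => by rw [map_add]; rfl
  map_add' m m' := DFunLike.ext _ _ fun x => map_add (φ x) m m'
  map_smul' r m := DFunLike.ext _ _ fun x => by
    exact (DFunLike.congr_fun (map_smul φ (MulOpposite.op r) x) m).symm

/-- The dual of a homomorphism of left modules. -/
def charDualRight (g : M →ₗ[R] N) : CharacterModule N →ₗ[Rᵐᵒᵖ] CharacterModule M where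
  toFun c := AddMonoidHom.comp c g.toAddMonoidHom
  map_add' _ _ := rfl
  map_smul' r c := DFunLike.ext _ _ fun m => congrArg c (map_smul g r.unop m).symm

/-- The dual of a homomorphism of right modules. -/
def charDualLeft (f : X →ₗ[Rᵐᵒᵖ] Y) : CharacterModule Y →ₗ[R] CharacterModule X where
  toFun c := AddMonoidHom.comp c f.toAddMonoidHom
  map_add' _ _ := rfl
  map_smul' r c := DFunLike.ext _ _ fun m => congrArg c (map_smul f (MulOpposite.op r) m).symm

/-- Characters extend along injective homomorphisms. -/
theorem exists_char_extension {G H : Type u} [AddCommGroup G] [AddCommGroup H] (f : G →+ H)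
    (hf : Function.Injective f) (c : CharacterModule G) :
    ∃ d : CharacterModule H, ∀ g, d (f g) = c g := by
  obtain ⟨d, hd⟩ := CharacterModule.dual_surjective_of_injective f.toIntLinearMap hf c
  exact ⟨d, fun g => DFunLike.congr_fun hd g⟩

/-- A linear map that vanishes on the kernel of a surjection factors through it. -/
theorem exists_factor_of_surjective {S P Q T : Type*} [Ring S] [AddCommGroup P] [Module S P]
    [AddCommGroup Q] [Module S Q] [AddCommGroup T] [Module S T] (g : P →ₗ[S] Q)
    (hg : Function.Surjective g) (φ : P →ₗ[S] T) (h : ∀ x, g x = 0 → φ x = 0) :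
    ∃ ψ : Q →ₗ[S] T, ∀ x, ψ (g x) = φ x := by
  refine ⟨(LinearMap.ker g).liftQ φ (fun x hx => h x hx) ∘ₗ
    (g.quotKerEquivOfSurjective hg).symm.toLinearMap, fun x => ?_⟩
  have : (g.quotKerEquivOfSurjective hg).symm (g x) = (LinearMap.ker g).mkQ x := by
    rw [LinearEquiv.symm_apply_eq]; rfl
  rw [LinearMap.comp_apply, LinearEquiv.coe_coe, this]
  rfl

/-- `- ⊗_R M` is right exact. -/
theorem balancedMap_exact {f : X →ₗ[Rᵐᵒᵖ] Y} {g : Y →ₗ[Rᵐᵒᵖ] Z} (hg : Function.Surjective g)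
    (hfg : ∀ y, g y = 0 → ∃ x, f x = y) (t : BalancedTensor R Y M)
    (ht : balancedMap g M t = 0) : ∃ s, balancedMap f M s = t := by
  by_contra hc
  obtain ⟨c, hc₀, hct⟩ := exists_char_separating (balancedMap f M).range (t := t) hc
  -- A character of `Y ⊗ M` is a homomorphism `Y → M*`. This one kills the image of `f`, hence
  -- factors through `Z`, so `c` kills everything that dies in `Z ⊗ M`.
  obtain ⟨ψ, hψ⟩ := exists_factor_of_surjective g hg (curryRight c) fun y hy => by
    obtain ⟨x, rfl⟩ := hfg y hy
    exact DFunLike.ext _ _ fun m => hc₀ _ ⟨btmul R x m, rfl⟩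
  have := balancedTensor_hom_congr (AddMonoidHom.comp (charOfRight ψ) (balancedMap g M)) c
    (fun y m => DFunLike.congr_fun (hψ y) m) t
  apply hct
  refine this.symm.trans ?_
  exact (congrArg (charOfRight ψ) ht).trans (map_zero _)

/-- `X ⊗_R -` is right exact. -/
theorem balancedMapRight_exact {f : L →ₗ[R] M} {g : M →ₗ[R] N} (hg : Function.Surjective g)
    (hfg : ∀ y, g y = 0 → ∃ x, f x = y) (t : BalancedTensor R X M)
    (ht : balancedMapRight X g t = 0) : ∃ s, balancedMapRight X f s = t := by
  by_contra hc
  obtain ⟨c, hc₀, hct⟩ := exists_char_separating (balancedMapRight X f).range (t := t) hc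
  obtain ⟨ψ, hψ⟩ := exists_factor_of_surjective g hg (transposeLeft (curryRight c)) fun y hy => by
    obtain ⟨x, rfl⟩ := hfg y hy
    exact DFunLike.ext _ _ fun m => hc₀ _ ⟨btmul R m x, rfl⟩
  have := balancedTensor_hom_congr
    (AddMonoidHom.comp (charOfRight (transposeRight ψ)) (balancedMapRight X g)) c
    (fun x m => DFunLike.congr_fun (hψ m) x) t
  apply hct
  refine this.symm.trans ?_
  exact (congrArg (charOfRight (transposeRight ψ)) ht).trans (map_zero _)

/-- Tensoring with a flat module preserves exactness. -/
theorem IsFlatModule.balancedMap_exact {M : ModuleCat.{u} R} (hM : IsFlatModule M)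
    {f : X →ₗ[Rᵐᵒᵖ] Y} {g : Y →ₗ[Rᵐᵒᵖ] Z}
    (hfg : ∀ y, g y = 0 → ∃ x, f x = y) (t : BalancedTensor R Y M)
    (ht : balancedMap g M t = 0) : ∃ s, balancedMap f M s = t := by
  -- Right exactness applies to `Y → range g`; flatness makes `range g ⊗ M → Z ⊗ M` injective.
  refine _root_.balancedMap_exact g.surjective_rangeRestrict
    (fun y hy => hfg y (congrArg Subtype.val hy)) t ?_
  apply hM (ModuleCat.of Rᵐᵒᵖ (LinearMap.range g)) (ModuleCat.of Rᵐᵒᵖ Z)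
    (ModuleCat.ofHom (LinearMap.range g).subtype) (Submodule.injective_subtype _)
  rw [map_zero]
  refine Eq.trans ?_ ht
  exact balancedMap_comp_apply g.rangeRestrict (LinearMap.range g).subtype t

/-- Tensoring with a projective right module preserves injectivity. -/
theorem balancedMapRight_injective [hX : Module.Projective Rᵐᵒᵖ X] {g : M →ₗ[R] N}
    (hg : Function.Injective g) : Function.Injective (balancedMapRight X g) := by
  classical
  obtain ⟨s, hs⟩ := Module.projective_def'.1 hX
  -- The section `s` of the free cover of `X` is a dual basis indexed by `X` itself. The coordinates
  -- are natural in `M` and, by `key`, determine a tensor.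
  let coord (M : Type u) [AddCommGroup M] [Module R M] (p : X) : BalancedTensor R X M →+ M :=
    balancedLift (AddMonoidHom.mk' (fun x => AddMonoidHom.mk' (fun m => (s x p).unop • m)
      fun m m' => smul_add _ _ _) fun x y => AddMonoidHom.ext fun m => by
        simp [add_smul]) fun x r m => by simp [mul_smul]
  -- Allowing all larger index sets lets two tensors be expanded over a common one.
  have key : ∀ t : BalancedTensor R X M, ∃ T : Finset X, ∀ T', T ⊆ T' →
      t = ∑ p ∈ T', btmul R p (coord M p t) := by
    intro t
    induction t using balancedTensor_induction with
    | zero => exact ⟨∅, fun T' _ => by simp [btmul_zero]⟩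
    | tmul x m =>
      refine ⟨(s x).support, fun T' hT' => ?_⟩
      have hx : x = ∑ p ∈ T', s x p • p := by
        conv_lhs => rw [← LinearMap.id_apply (R := Rᵐᵒᵖ) x, ← hs]
        simp only [LinearMap.comp_apply, Finsupp.linearCombination_apply]
        exact Finsupp.sum_of_support_subset _ hT' _ (by simp)
      conv_lhs => rw [hx, sum_btmul]
      exact Finset.sum_congr rfl fun p _ => smul_btmul (s x p).unop p m
    | add t t' ht ht' =>
      obtain ⟨T, hT⟩ := ht
      obtain ⟨T', hT'⟩ := ht'
      refine ⟨T ∪ T', fun U hU => ?_⟩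
      simp only [map_add, btmul_add, Finset.sum_add_distrib]
      rw [← hT U (Finset.union_subset_left hU), ← hT' U (Finset.union_subset_right hU)]
  rw [injective_iff_map_eq_zero]
  intro t ht
  obtain ⟨T, hT⟩ := key t
  rw [hT T subset_rfl]
  refine Finset.sum_eq_zero fun p _ => ?_
  have := balancedTensor_hom_congr ((coord N p).comp (balancedMapRight X g))
    (g.toAddMonoidHom.comp (coord M p)) (fun x m => (map_smul g _ _).symm) t
  have h0 : g (coord M p t) = 0 := by
    rw [← map_zero (coord N p), ← ht]
    exact this.symm
  rw [hg (h0.trans (map_zero g).symm), btmul_zero]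

end TensorTools

/-! ### H-unitary modules and the condition `M = A M`. -/

section Tor

variable {R : Type u} [Ring R]

/-- Vanishing of `Tor` in terms of elements of a projective resolution. -/
theorem isZero_torObj_iff {Q : ModuleCat.{u} Rᵐᵒᵖ} (P : ProjectiveResolution Q) (n : ℕ)
    (M : ModuleCat.{u} R) :
    Limits.IsZero (torObj n Q M) ↔ ∀ t : BalancedTensor R (P.complex.X n) M,
      balancedMap (P.complex.d n ((ComplexShape.down ℕ).next n)).hom M t = 0 →
        ∃ s, balancedMap (P.complex.d (n + 1) n).hom M s = t := by
  rw [torObj, (P.isoLeftDerivedObj (tensorFunctor M) n).isZero_iff]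
  rw [HomologicalComplex.homologyFunctor_obj, ← HomologicalComplex.exactAt_iff_isZero_homology,
    HomologicalComplex.exactAt_iff' _ (n + 1) n _ (ChainComplex.prev ℕ n) rfl,
    ShortComplex.ab_exact_iff]
  rfl

theorem balancedMap_d_comp_d {Q : ModuleCat.{u} Rᵐᵒᵖ} (P : ProjectiveResolution Q) (i j k : ℕ)
    (M : Type u) [AddCommGroup M] [Module R M] (s : BalancedTensor R (P.complex.X i) M) :
    balancedMap (P.complex.d j k).hom M (balancedMap (P.complex.d i j).hom M s) = 0 := by
  rw [balancedMap_comp_apply, ← ModuleCat.hom_comp, P.complex.d_comp_d i j k, ModuleCat.hom_zero,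
    balancedMap_zero]

instance projectiveResolution_projective {Q : ModuleCat.{u} Rᵐᵒᵖ} (P : ProjectiveResolution Q)
    (n : ℕ) : Module.Projective Rᵐᵒᵖ (P.complex.X n) :=
  (IsProjective.iff_projective _).2 (P.projective n)

theorem CategoryTheory.ProjectiveResolution.exists_augmentation {Q : ModuleCat.{u} Rᵐᵒᵖ}
    (P : ProjectiveResolution Q) : ∃ π : P.complex.X 0 →ₗ[Rᵐᵒᵖ] Q, Function.Surjective π ∧
      ∀ y, π y = 0 ↔ ∃ x, (P.complex.d 1 0).hom x = y := by
  have h₁ : Function.Surjective (P.π.f 0).hom := by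
    rw [← ModuleCat.epi_iff_surjective]
    infer_instance
  refine ⟨(P.π.f 0).hom, h₁, fun y => ⟨(ShortComplex.moduleCat_exact_iff _).1 P.exact₀ y, ?_⟩⟩
  rintro ⟨x, rfl⟩
  exact congrArg (fun f => f.hom x) P.complex_d_comp_π_f_zero

variable {A : Type u} [NonUnitalRing A]

/-- One resolution of `R / A` serves all `M`, and its terms are projective, so an exact sequence of
modules `M` gives an exact sequence of complexes in which elements can be chased. -/
theorem hUnitary_iff (E : UnitalExtension A R) (P : ProjectiveResolution E.quotient)
    (M : ModuleCat.{u} R) :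
    HUnitary E M ↔ ∀ n, ∀ t : BalancedTensor R (P.complex.X n) M,
      balancedMap (P.complex.d n ((ComplexShape.down ℕ).next n)).hom M t = 0 →
        ∃ s, balancedMap (P.complex.d (n + 1) n).hom M s = t :=
  forall_congr' fun n => isZero_torObj_iff P n M

/-- The h-unitary modules are closed under extensions. -/
theorem HUnitary.extension (E : UnitalExtension A R) {M' M M'' : ModuleCat.{u} R}
    (f : M' →ₗ[R] M) (g : M →ₗ[R] M'') (hf : Function.Injective f)
    (hfg : Function.Exact f g) (hg : Function.Surjective g)
    (h' : HUnitary E M') (h'' : HUnitary E M'') : HUnitary E M := by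
  let P := projectiveResolution E.quotient
  rw [hUnitary_iff E P] at h' h'' ⊢
  intro n t ht
  obtain ⟨s'', hs''⟩ := h'' n (balancedMapRight _ g t) (by
    rw [balancedMap_balancedMapRight, ht, map_zero])
  obtain ⟨s, rfl⟩ := balancedMapRight_surjective hg s''
  obtain ⟨t', ht'⟩ := balancedMapRight_exact hg (fun y hy => (hfg y).1 hy)
    (t - balancedMap (P.complex.d (n + 1) n).hom M s) (by
      rw [map_sub, ← hs'', balancedMap_balancedMapRight, sub_self])
  obtain ⟨s', rfl⟩ := h' n t' (by
    apply balancedMapRight_injective hf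
    rw [← balancedMap_balancedMapRight, ht', map_sub, ht, balancedMap_d_comp_d, map_zero, sub_zero])
  refine ⟨s + balancedMapRight _ f s', ?_⟩
  rw [map_add, balancedMap_balancedMapRight, ht', add_sub_cancel]

/-- The h-unitary modules are closed under kernels of surjections. -/
theorem HUnitary.kernel (E : UnitalExtension A R) {M' M M'' : ModuleCat.{u} R}
    (f : M' →ₗ[R] M) (g : M →ₗ[R] M'') (hf : Function.Injective f)
    (hfg : Function.Exact f g) (hg : Function.Surjective g)
    (h : HUnitary E M) (h'' : HUnitary E M'') : HUnitary E M' := by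
  let P := projectiveResolution E.quotient
  rw [hUnitary_iff E P] at h h'' ⊢
  have gf : g ∘ₗ f = 0 := LinearMap.ext fun x => (hfg _).2 ⟨x, rfl⟩
  intro n t' ht'
  obtain ⟨s, hs⟩ := h n (balancedMapRight _ f t') (by
    rw [balancedMap_balancedMapRight, ht', map_zero])
  -- The chain `s` bounding the image of `t'` becomes a cycle over `M''` one degree higher: this is
  -- the connecting map from `Tor` in degree `n + 1`.
  obtain ⟨u'', hu''⟩ := h'' (n + 1) (balancedMapRight _ g s) (by
    rw [ChainComplex.next_nat_succ, balancedMap_balancedMapRight, hs, balancedMapRight_comp_apply,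
      gf, balancedMapRight_zero])
  obtain ⟨u, rfl⟩ := balancedMapRight_surjective hg u''
  obtain ⟨s', hs'⟩ := balancedMapRight_exact hg (fun y hy => (hfg y).1 hy)
    (s - balancedMap (P.complex.d (n + 1 + 1) (n + 1)).hom M u) (by
      rw [map_sub, ← hu'', balancedMap_balancedMapRight, sub_self])
  refine ⟨s', balancedMapRight_injective hf ?_⟩
  rw [← balancedMap_balancedMapRight, hs', map_sub, hs, balancedMap_d_comp_d, sub_zero]

/-- `M = A M`. -/
def IsUnitaryModule (E : UnitalExtension A R) (M : Type u) [AddCommGroup M] [Module R M] : Prop :=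
  AddSubgroup.closure {x : M | ∃ (a : A) (m : M), x = E.toHom a • m} = ⊤

/-- The subgroup `A M` is a submodule. -/
def unitaryPart (E : UnitalExtension A R) (M : Type u) [AddCommGroup M] [Module R M] :
    Submodule R M where
  __ := AddSubgroup.closure {x : M | ∃ (a : A) (m : M), x = E.toHom a • m}
  smul_mem' r x hx := by
    change r • x ∈ AddSubgroup.closure {x : M | ∃ (a : A) (m : M), x = E.toHom a • m}
    refine AddSubgroup.closure_induction (fun x hx => ?_) ?_ (fun x y _ _ hx hy => ?_)
      (fun x _ hx => ?_) (show x ∈ AddSubgroup.closure _ from hx)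
    · obtain ⟨a, m, rfl⟩ := hx
      obtain ⟨b, hb⟩ := E.mul_left_mem r a
      exact AddSubgroup.subset_closure ⟨b, m, by rw [hb, mul_smul]⟩
    · rw [smul_zero]; exact zero_mem _
    · rw [smul_add]; exact add_mem hx hy
    · rw [smul_neg]; exact neg_mem hx

theorem isUnitaryModule_iff (E : UnitalExtension A R) (M : Type u) [AddCommGroup M] [Module R M] :
    IsUnitaryModule E M ↔ ∀ m : M, m ∈ unitaryPart E M :=
  AddSubgroup.eq_top_iff' _

theorem smul_mem_unitaryPart (E : UnitalExtension A R) {M : Type u} [AddCommGroup M] [Module R M]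
    (a : A) (m : M) : E.toHom a • m ∈ unitaryPart E M :=
  AddSubgroup.subset_closure ⟨a, m, rfl⟩

theorem IsUnitaryModule.of_surjective (E : UnitalExtension A R) {M N : Type u} [AddCommGroup M]
    [Module R M] [AddCommGroup N] [Module R N] (g : M →ₗ[R] N) (hg : Function.Surjective g)
    (hM : IsUnitaryModule E M) : IsUnitaryModule E N := by
  rw [IsUnitaryModule, AddSubgroup.eq_top_iff']
  intro n
  obtain ⟨m, rfl⟩ := hg n
  refine AddSubgroup.closure_induction (p := fun m _ => g m ∈ AddSubgroup.closure _)
    (fun x hx => ?_) ?_ (fun x y _ _ hx hy => ?_)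
    (fun x _ hx => ?_) (show m ∈ AddSubgroup.closure _ by rw [hM]; trivial)
  · obtain ⟨a, m, rfl⟩ := hx
    exact AddSubgroup.subset_closure ⟨a, g m, map_smul g _ _⟩
  · rw [map_zero]; exact zero_mem _
  · rw [map_add]; exact add_mem hx hy
  · rw [map_neg]; exact neg_mem hx

/-- The functor `(R / A) ⊗_R -` vanishes exactly on the modules with `M = A M`. -/
theorem isUnitaryModule_iff_tensor (E : UnitalExtension A R) (M : Type u) [AddCommGroup M]
    [Module R M] : IsUnitaryModule E M ↔ ∀ t : BalancedTensor R E.quotient M, t = 0 := by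
  constructor
  · intro hM t
    induction t using balancedTensor_induction with
    | zero => rfl
    | add s t hs ht => rw [hs, ht, add_zero]
    | tmul x m =>
      refine AddSubgroup.closure_induction (p := fun m _ => btmul R x m = 0) (fun m hm => ?_) ?_
        (fun m m' _ _ hm hm' => ?_) (fun m _ hm => ?_)
        (show m ∈ AddSubgroup.closure _ by rw [hM]; trivial)
      · obtain ⟨a, m, rfl⟩ := hm
        obtain ⟨r, rfl⟩ := Submodule.mkQ_surjective E.rightIdeal x
        refine (smul_btmul (E.toHom a) (X := E.quotient) (E.rightIdeal.mkQ r) m).symm.trans ?_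
        have : MulOpposite.op (E.toHom a) • E.rightIdeal.mkQ r = 0 := by
          rw [← map_smul, Submodule.mkQ_apply, Submodule.Quotient.mk_eq_zero]
          exact E.mul_left_mem r a
        exact (congrArg (fun y : E.quotient => btmul R y m) this).trans (zero_btmul m)
      · exact btmul_zero x
      · rw [btmul_add, hm, hm', add_zero]
      · have := btmul_add (R := R) x m (-m)
        rwa [add_neg_cancel, btmul_zero, hm, zero_add, eq_comm] at this
  · intro h
    rw [isUnitaryModule_iff]
    intro m
    rw [← Submodule.Quotient.mk_eq_zero]
    -- The map `R / A ⊗ M → M / A M` induced by the action; its value on `1 ⊗ m` is the class of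
    -- `m`.
    let act (x : R ⧸ E.rightIdeal) : M →+ M ⧸ unitaryPart E M :=
      QuotientAddGroup.lift E.rightIdeal.toAddSubgroup
        (AddMonoidHom.mk' (fun r : R => AddMonoidHom.mk'
          (fun m : M => (Submodule.Quotient.mk (r • m) : M ⧸ unitaryPart E M))
          (fun m m' => by rw [smul_add]; rfl))
          (fun r s => AddMonoidHom.ext fun m => by
            change Submodule.Quotient.mk ((r + s) • m) = _
            rw [add_smul]; rfl))
        (by
          rintro _ ⟨a, rfl⟩
          exact AddMonoidHom.ext fun m =>
            (Submodule.Quotient.mk_eq_zero _).2 (smul_mem_unitaryPart E a m)) x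
    let f : BalancedTensor R E.quotient M →+ M ⧸ unitaryPart E M :=
      balancedLift (AddMonoidHom.mk' act fun x y => map_add _ x y) fun x r m => by
        obtain ⟨s, rfl⟩ := Submodule.mkQ_surjective E.rightIdeal x
        exact congrArg Submodule.Quotient.mk (mul_smul s r m)
    have := congrArg f (h (btmul R (E.rightIdeal.mkQ 1) m))
    rw [map_zero] at this
    refine Eq.trans ?_ this
    exact congrArg Submodule.Quotient.mk (one_smul R m).symm

/-- Only degree zero matters: every element of `P₀ ⊗ M` is a cycle, hence a boundary, and boundaries
die in `R / A ⊗ M`, onto which `P₀ ⊗ M` maps. -/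
theorem HUnitary.isUnitaryModule (E : UnitalExtension A R) {M : ModuleCat.{u} R}
    (hM : HUnitary E M) : IsUnitaryModule E M := by
  let P := projectiveResolution E.quotient
  rw [hUnitary_iff E P] at hM
  rw [isUnitaryModule_iff_tensor]
  obtain ⟨π, hπ, hd⟩ := P.exists_augmentation
  intro t
  obtain ⟨s, rfl⟩ := balancedMap_surjective hπ t
  obtain ⟨s, rfl⟩ := hM 0 s (by
    rw [ChainComplex.next_nat_zero, P.complex.shape 0 0 (by simp), ModuleCat.hom_zero,
      balancedMap_zero])
  have : π ∘ₗ (P.complex.d 1 0).hom = 0 := LinearMap.ext fun x => (hd _).2 ⟨x, rfl⟩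
  rw [balancedMap_comp_apply, this, balancedMap_zero]

/-- Flat modules with `M = A M` are h-unitary. -/
theorem HUnitary.of_flat (E : UnitalExtension A R) {M : ModuleCat.{u} R}
    (hM : IsFlatModule M) (hA : IsUnitaryModule E M) : HUnitary E M := by
  let P := projectiveResolution E.quotient
  rw [hUnitary_iff E P]
  rw [isUnitaryModule_iff_tensor] at hA
  rintro (_ | n) t ht
  · obtain ⟨π, -, hd⟩ := P.exists_augmentation
    exact hM.balancedMap_exact (g := π) (fun y hy => (hd y).1 hy) t (hA _)
  · refine hM.balancedMap_exact (fun y hy => ?_) t ht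
    rw [ChainComplex.next_nat_succ] at hy
    exact (ShortComplex.moduleCat_exact_iff _).1 (P.exact_succ n) y hy

end Tor

/-! ### The equational criterion of flatness. -/

section EquationalFlatness

variable {R : Type u} [Ring R]

/-- The tuples `m` generated by the tuples `(b i • p)` with `∑ r i * b i = 0`: the solutions of
`∑ r i • m i = 0` that come from relations in `R`. -/
def trivialSolutions {n : ℕ} (r : Fin n → R) (M : Type*) [AddCommGroup M] [Module R M] :
    AddSubgroup (Fin n → M) :=
  AddSubgroup.closure {v | ∃ (b : Fin n → R) (p : M), ∑ i, r i * b i = 0 ∧ v = fun i => b i • p}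

/-- The equational criterion of flatness. -/
def EquationallyFlat (R : Type u) [Ring R] (M : Type*) [AddCommGroup M] [Module R M] : Prop :=
  ∀ (n : ℕ) (r : Fin n → R) (m : Fin n → M), ∑ i, r i • m i = 0 → m ∈ trivialSolutions r M

variable {M N : Type*} [AddCommGroup M] [Module R M] [AddCommGroup N] [Module R N]

theorem trivialSolutions_map {n : ℕ} {r : Fin n → R} (φ : M →ₗ[R] N) {m : Fin n → M}
    (hm : m ∈ trivialSolutions r M) : (fun i => φ (m i)) ∈ trivialSolutions r N := by
  induction hm using AddSubgroup.closure_induction with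
  | mem v hv =>
    obtain ⟨b, p, hb, rfl⟩ := hv
    exact AddSubgroup.subset_closure ⟨b, φ p, hb, funext fun i => map_smul φ _ _⟩
  | zero =>
    simp only [Pi.zero_apply, map_zero]
    exact zero_mem _
  | add v w _ _ hv hw =>
    simp only [Pi.add_apply, map_add]
    exact add_mem hv hw
  | neg v _ hv =>
    simp only [Pi.neg_apply, map_neg]
    exact neg_mem hv

/-- If `(r d) b = 0` then `r (d b) = 0`. With `d` a matrix over `A`, this replaces coefficients `r`
in `R` by coefficients `r d` in `A`. -/
theorem trivialSolutions_matrix {n k : ℕ} {r : Fin n → R} {c : Fin k → R}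
    (d : Fin n → Fin k → R) (hd : ∀ j, c j = ∑ i, r i * d i j) {y : Fin k → M}
    (hy : y ∈ trivialSolutions c M) : (fun i => ∑ j, d i j • y j) ∈ trivialSolutions r M := by
  induction hy using AddSubgroup.closure_induction with
  | mem v hv =>
    obtain ⟨b, p, hb, rfl⟩ := hv
    refine AddSubgroup.subset_closure ⟨fun i => ∑ j, d i j * b j, p, ?_, ?_⟩
    · rw [← hb]
      simp only [hd, Finset.mul_sum, Finset.sum_mul, mul_assoc]
      exact Finset.sum_comm
    · funext i
      simp [Finset.sum_smul, mul_smul]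
  | zero =>
    simp only [Pi.zero_apply, smul_zero, Finset.sum_const_zero]
    exact zero_mem _
  | add v w _ _ hv hw =>
    simp only [Pi.add_apply, smul_add, Finset.sum_add_distrib]
    exact add_mem hv hw
  | neg v _ hv =>
    simp only [Pi.neg_apply, smul_neg, Finset.sum_neg_distrib]
    exact neg_mem hv

theorem EquationallyFlat.of_retract (i : N →ₗ[R] M) (ρ : M →ₗ[R] N) (h : ∀ x, ρ (i x) = x)
    (hM : EquationallyFlat R M) : EquationallyFlat R N := by
  intro n r m hm
  have := hM n r (fun j => i (m j)) (by simp only [← map_smul, ← map_sum, hm, map_zero])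
  simpa [h] using trivialSolutions_map ρ this

/-- A relation in a free module holds coordinatewise, so each column of coordinates is a relation in
`R`. -/
theorem EquationallyFlat.finsupp (ι : Type*) : EquationallyFlat R (ι →₀ R) := by
  classical
  intro n r x hx
  let T : Finset ι := Finset.univ.biUnion fun i => (x i).support
  have hT : x = ∑ z ∈ T, fun i => x i z • Finsupp.single z (1 : R) := by
    funext i
    rw [Finset.sum_apply]
    have : (x i).support ⊆ T := Finset.subset_biUnion_of_mem (fun i => (x i).support)
      (Finset.mem_univ i)
    conv_lhs => rw [← Finsupp.sum_single (x i), Finsupp.sum_of_support_subset _ this _ (by simp)]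
    simp
  rw [hT]
  refine sum_mem fun z _ => AddSubgroup.subset_closure ⟨fun i => x i z, Finsupp.single z 1, ?_, rfl⟩
  simpa using DFunLike.congr_fun hx z

/-- Flat modules satisfy the equational criterion. -/
theorem IsFlatModule.equationallyFlat {M : ModuleCat.{u} R} (hM : IsFlatModule M) :
    EquationallyFlat R M := by
  classical
  intro n r m hm
  -- The relation says that `∑ eᵢ ⊗ mᵢ` lies in the kernel of `f ⊗ M`. By flatness it comes from
  -- `ker f ⊗ M`, whose elementary tensors are exactly the generating trivial solutions.
  let f : (Fin n → R) →ₗ[Rᵐᵒᵖ] R :=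
    { toFun := fun x => ∑ i, r i * x i
      map_add' := fun x y => by simp [mul_add, Finset.sum_add_distrib]
      map_smul' := fun s x => by simp [Finset.sum_mul, mul_assoc] }
  let coord (i : Fin n) : BalancedTensor R (Fin n → R) M →+ M :=
    balancedLift (AddMonoidHom.mk' (fun x => AddMonoidHom.mk' (fun m => x i • m)
      fun m m' => smul_add _ _ _) fun x y => AddMonoidHom.ext fun m => by
        simp [add_smul]) fun x r m => by simp [mul_smul]
  let t : BalancedTensor R (Fin n → R) M := ∑ i, btmul R (Pi.single i 1 : Fin n → R) (m i)
  have ht : balancedMap f M t = 0 := by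
    have h1 : ∀ i, f (Pi.single i 1) = MulOpposite.op (r i) • (1 : R) := fun i => by
      change ∑ j, r j * (Pi.single i 1 : Fin n → R) j = _
      simp [Pi.single_apply]
    simp only [t, map_sum, balancedMap_btmul, h1, smul_btmul, ← btmul_sum, hm, btmul_zero]
  obtain ⟨s, hs⟩ := hM.balancedMap_exact (f := (LinearMap.ker f).subtype) (g := f)
    (fun y hy => ⟨⟨y, hy⟩, rfl⟩) t ht
  have key : ∀ s : BalancedTensor R (LinearMap.ker f) M,
      (fun i => coord i (balancedMap (LinearMap.ker f).subtype M s)) ∈ trivialSolutions r M := by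
    intro s
    induction s using balancedTensor_induction with
    | zero =>
      simp only [map_zero]
      exact zero_mem _
    | tmul x p => exact AddSubgroup.subset_closure ⟨x, p, x.2, rfl⟩
    | add s t hs ht =>
      simp only [map_add]
      exact add_mem hs ht
  convert! key s with i
  rw [hs, map_sum, Finset.sum_eq_single i]
  · simp [coord]
  · intro j _ hj
    simp [coord, hj.symm]
  · simp

theorem char_sum_apply {G ι : Type*} [AddCommGroup G] (s : Finset ι) (c : ι → CharacterModule G)
    (g : G) : (∑ i ∈ s, c i) g = ∑ i ∈ s, c i g :=
  map_sum (AddMonoidHom.mk' (fun c : CharacterModule G => c g) fun _ _ => rfl) c s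

/-- The character module of an equationally flat module is injective. -/
theorem EquationallyFlat.injective_characterModule {M : Type u} [AddCommGroup M] [Module R M]
    (hM : EquationallyFlat R M) : Module.Injective Rᵐᵒᵖ (CharacterModule M) := by
  refine Module.Baer.injective fun I g => ?_
  -- Baer's criterion for a right ideal `I` and `g : I → M*`. If `v` kills the kernel of the
  -- multiplication `u`, it factors through `I M ⊆ M`, and an extension to a character `c` of `M`
  -- gives `g x = c x`. That `v` kills this kernel follows from equational flatness: for a trivial
  -- solution, `∑ g(xᵢ)(bᵢ p) = g(∑ xᵢ bᵢ)(p) = 0`.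
  let u : I ⊗[ℤ] M →+ M := TensorProduct.liftAddHom
    (AddMonoidHom.mk' (fun x => AddMonoidHom.mk' (fun m => x.1.unop • m)
      fun m m' => smul_add _ _ _) fun x y => AddMonoidHom.ext fun m => by simp [add_smul])
    fun k x m => by
      change (k • x.1.unop) • m = x.1.unop • k • m
      rw [smul_assoc, smul_comm]
  let v : I ⊗[ℤ] M →+ AddCircle (1 : ℚ) := TensorProduct.liftAddHom
    (AddMonoidHom.mk' (fun x => (g x : M →+ AddCircle (1 : ℚ))) fun x y => map_add g x y)
    fun k x m => by
      change g (k • x) m = g x (k • m)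
      rw [map_zsmul, map_zsmul]; rfl
  have huv : ∀ t, u t = 0 → v t = 0 := by
    intro t ht
    obtain ⟨n, x, m, rfl⟩ : ∃ (n : ℕ) (x : Fin n → I) (m : Fin n → M),
        t = ∑ i, x i ⊗ₜ[ℤ] m i := by
      obtain ⟨S, rfl⟩ := TensorProduct.exists_finset t
      refine ⟨S.card, fun i => (S.equivFin.symm i).1.1, fun i => (S.equivFin.symm i).1.2, ?_⟩
      rw [← Finset.sum_coe_sort S]
      exact (Equiv.sum_comp S.equivFin.symm fun i : S => i.1.1 ⊗ₜ[ℤ] i.1.2).symm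
    have hm : m ∈ trivialSolutions (fun i => (x i).1.unop) M := hM _ _ _ (by
      rw [map_sum] at ht; exact ht)
    rw [map_sum]
    change ∑ i, g (x i) (m i) = 0
    clear ht
    induction hm using AddSubgroup.closure_induction with
    | mem w hw =>
      obtain ⟨b, p, hb, rfl⟩ := hw
      have h0 : ∑ i, MulOpposite.op (b i) • x i = 0 := by
        apply Subtype.ext
        apply MulOpposite.unop_injective
        simpa using hb
      have := DFunLike.congr_fun (congrArg g h0) p
      rw [map_sum, map_zero] at this
      rw [char_sum_apply] at this
      simp only [map_smul, charRight_smul_apply] at this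
      exact this
    | zero => simp
    | add v w _ _ hv hw => simp [Finset.sum_add_distrib, hv, hw]
    | neg v _ hv => simp [hv]
  obtain ⟨w, hw⟩ := exists_factor_of_surjective u.toIntLinearMap.rangeRestrict
    u.toIntLinearMap.surjective_rangeRestrict v.toIntLinearMap
    fun t ht => huv t (congrArg Subtype.val ht)
  obtain ⟨c, hc⟩ := exists_char_extension (LinearMap.range u.toIntLinearMap).subtype.toAddMonoidHom
    Subtype.val_injective w.toAddMonoidHom
  refine ⟨LinearMap.toSpanSingleton Rᵐᵒᵖ _ c, fun x hx => DFunLike.ext _ _ fun m => ?_⟩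
  exact (hc (u.toIntLinearMap.rangeRestrict (⟨x, hx⟩ ⊗ₜ m))).trans (hw _)

/-- Since `M*` is injective, every map `X → M*`, that is, every character of `X ⊗ M`, extends to
`Y`; so no character detects an element of the kernel. -/
theorem EquationallyFlat.isFlatModule {M : ModuleCat.{u} R} (hM : EquationallyFlat R M) :
    IsFlatModule M := by
  intro X Y f hf
  rw [injective_iff_map_eq_zero]
  intro t ht
  by_contra h
  obtain ⟨χ, -, hχ⟩ := exists_char_separating (⊥ : AddSubgroup (BalancedTensor R X M)) (t := t) h
  have := hM.injective_characterModule
  obtain ⟨h, hh⟩ := Module.Injective.extension_property Rᵐᵒᵖ _ _ _ f.hom hf (curryRight χ)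
  have := balancedTensor_hom_congr (AddMonoidHom.comp (charOfRight h) (balancedMap f.hom M)) χ
    (fun x m => DFunLike.congr_fun (LinearMap.congr_fun hh x) m) t
  exact hχ (this.symm.trans ((congrArg (charOfRight h) ht).trans (map_zero _)))

/-- This replaces the homological definition of `ℱ` by two conditions on elements, which are easy to
follow through submodules, quotients and unions. -/
theorem hUnitaryFlat_iff {A : Type u} [NonUnitalRing A] (E : UnitalExtension A R)
    (M : ModuleCat.{u} R) : HUnitaryFlat E M ↔ EquationallyFlat R M ∧ IsUnitaryModule E M :=
  ⟨fun h => ⟨h.2.equationallyFlat, h.1.isUnitaryModule⟩,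
    fun h => ⟨HUnitary.of_flat E h.1.isFlatModule h.2, h.1.isFlatModule⟩⟩

/-- Quotients by directed unions. -/
theorem EquationallyFlat.quotient_iSup {ι : Type*} [Nonempty ι] (S : ι → Submodule R M)
    (hS : Directed (· ≤ ·) S) (h : ∀ i, EquationallyFlat R (M ⧸ S i)) :
    EquationallyFlat R (M ⧸ ⨆ i, S i) := by
  intro n r x hx
  choose m hm using fun i => Submodule.mkQ_surjective (⨆ i, S i) (x i)
  obtain rfl : (fun i => (⨆ i, S i).mkQ (m i)) = x := funext hm
  simp only [← map_smul, ← map_sum] at hx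
  rw [Submodule.mkQ_apply, Submodule.Quotient.mk_eq_zero, Submodule.mem_iSup_of_directed _ hS] at hx
  obtain ⟨i, hi⟩ := hx
  rw [← Submodule.Quotient.mk_eq_zero, ← Submodule.mkQ_apply, map_sum] at hi
  simp only [map_smul] at hi
  exact trivialSolutions_map (Submodule.factor (le_iSup S i)) (h i n r _ hi)

end EquationalFlatness

/-! ### Closing small sets under finitary operations. -/

section SmallClosure

/-- Closing a subset under a family of at most `κ` finitary operations with countably many values
does not increase the cardinality beyond `κ`. -/
theorem exists_small_closed {A M : Type u} {κ : Cardinal.{u}} (hκ : ℵ₀ ≤ κ) (hA : #A ≤ κ)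
    (f : ∀ n : ℕ, (Fin n → A) → (Fin n → M) → Set M) (hf : ∀ n a y, (f n a y).Countable)
    (T : Set M) (hT : #T ≤ κ) :
    ∃ U : Set M, T ⊆ U ∧ #U ≤ κ ∧ ∀ n a y, (∀ i, y i ∈ U) → f n a y ⊆ U := by
  let step (U : Set M) : Set M :=
    U ∪ ⋃ p : Σ n : ℕ, (Fin n → A) × (Fin n → U), f p.1 p.2.1 fun i => p.2.2 i
  have hsum : (Cardinal.sum fun _ : ℕ => κ) ≤ κ := by
    rw [Cardinal.sum_const]
    simpa using Cardinal.mul_le_of_le hκ hκ le_rfl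
  have hstep : ∀ U : Set M, #U ≤ κ → #(step U) ≤ κ := by
    intro U hU
    refine (Cardinal.mk_union_le _ _).trans (Cardinal.add_le_of_le hκ hU ?_)
    refine (Cardinal.mk_iUnion_le_sum_mk).trans ?_
    refine (Cardinal.sum_le_sum _ (fun _ => ℵ₀) fun p => (hf _ _ _).le_aleph0).trans ?_
    rw [Cardinal.sum_const']
    refine Cardinal.mul_le_of_le hκ ?_ hκ
    rw [Cardinal.mk_sigma]
    have hfin : ∀ (n : ℕ) (V : Type u), #V ≤ κ → #(Fin n → V) ≤ κ := by
      intro n V hV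
      rw [Cardinal.mk_arrow]
      simp only [Cardinal.mk_fin, Cardinal.lift_natCast, Cardinal.lift_uzero]
      refine (Cardinal.power_le_power_right hV).trans ?_
      exact_mod_cast Cardinal.power_nat_le (n := n) hκ
    refine (Cardinal.sum_le_sum _ (fun _ : ℕ => κ) fun n => ?_).trans hsum
    rw [Cardinal.mk_prod, Cardinal.lift_id, Cardinal.lift_id]
    exact Cardinal.mul_le_of_le hκ (hfin n A hA) (hfin n U hU)
  -- Countably many rounds suffice, since finitely many arguments all appear at a finite stage.
  let V (n : ℕ) : Set M := step^[n] T
  have hV : ∀ n, V (n + 1) = step (V n) := fun n => Function.iterate_succ_apply' step n T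
  have hmono : Monotone V := monotone_nat_of_le_succ fun n => by
    rw [hV]; exact Set.subset_union_left
  have hcard : ∀ n, #(V n) ≤ κ := by
    intro n
    induction n with
    | zero => exact hT
    | succ n ih => rw [hV]; exact hstep _ ih
  refine ⟨⋃ n, V n, Set.subset_iUnion V 0, ?_, ?_⟩
  · have h := Cardinal.mk_iUnion_le_sum_mk_lift (f := V)
    rw [Cardinal.lift_uzero] at h
    exact (h.trans (Cardinal.sum_le_sum _ _ hcard)).trans hsum
  · intro n a y hy
    choose k hk using fun i => Set.mem_iUnion.1 (hy i)
    let N := Finset.univ.sup k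
    have hN : ∀ i, y i ∈ V N := fun i => hmono (Finset.le_sup (Finset.mem_univ i)) (hk i)
    refine Set.Subset.trans ?_ (Set.subset_iUnion V (N + 1))
    rw [hV]
    refine Set.Subset.trans ?_ Set.subset_union_right
    exact Set.subset_iUnion (fun p : Σ n : ℕ, (Fin n → A) × (Fin n → V N) =>
      f p.1 p.2.1 fun i => p.2.2 i) ⟨n, a, fun i => ⟨y i, hN i⟩⟩

end SmallClosure

/-! ### Small pure submodules. -/

section Deconstruction

variable {A : Type u} [NonUnitalRing A] {R : Type u} [Ring R] (E : UnitalExtension A R)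
variable {M : Type u} [AddCommGroup M] [Module R M]

variable {E} in
theorem IsUnitaryModule.exists_sum (hM : IsUnitaryModule E M) (m : M) :
    ∃ (k : ℕ) (a : Fin k → A) (y : Fin k → M), m = ∑ j, E.toHom (a j) • y j := by
  have hm : m ∈ AddSubgroup.closure {x : M | ∃ (a : A) (m : M), x = E.toHom a • m} := by
    rw [hM]; trivial
  induction hm using AddSubgroup.closure_induction with
  | mem v hv =>
    obtain ⟨a, p, rfl⟩ := hv
    exact ⟨1, fun _ => a, fun _ => p, by simp⟩
  | zero => exact ⟨0, Fin.elim0, Fin.elim0, by simp⟩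
  | add v w _ _ hv hw =>
    obtain ⟨k, a, y, rfl⟩ := hv
    obtain ⟨k', a', y', rfl⟩ := hw
    exact ⟨k + k', Fin.append a a', Fin.append y y', by simp [Fin.sum_univ_add]⟩
  | neg v _ hv =>
    obtain ⟨k, a, y, rfl⟩ := hv
    exact ⟨k, -a, y, by simp⟩

variable {E} in
theorem IsUnitaryModule.exists_matrix (hM : IsUnitaryModule E M) {n : ℕ} (m : Fin n → M) :
    ∃ (k : ℕ) (a : Fin n → Fin k → A) (y : Fin k → M),
      ∀ i, m i = ∑ j, E.toHom (a i j) • y j := by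
  choose k a y h using fun i => hM.exists_sum (m i)
  let e := Fintype.equivFin (Σ i, Fin (k i))
  -- The separate expansions are put over the disjoint union of their index sets, with zero
  -- coefficients outside the own block.
  refine ⟨_, fun i j => if h : (e.symm j).1 = i then a i (h ▸ (e.symm j).2) else 0,
    fun j => y _ (e.symm j).2, fun i => ?_⟩
  rw [Equiv.sum_comp e.symm fun p : Σ i, Fin (k i) =>
    E.toHom (if h : p.1 = i then a i (h ▸ p.2) else 0) • y _ p.2, Fintype.sum_sigma,
    Finset.sum_eq_single i]
  · simpa using h i
  · intro j _ hj
    simp [hj]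
  · simp

/-- A trivial solution involves finitely many elements `p`, and stays trivial in any submodule
containing them. This makes triviality inside a submodule a finitary closure condition. -/
theorem trivialSolutions_exists_finset {n : ℕ} {r : Fin n → R} {m : Fin n → M}
    (hm : m ∈ trivialSolutions r M) : ∃ T : Finset M, ∀ S : Submodule R M, ↑T ⊆ (S : Set M) →
      ∃ m' ∈ trivialSolutions r S, ∀ i, (m' i : M) = m i := by
  classical
  induction hm using AddSubgroup.closure_induction with
  | mem v hv =>
    obtain ⟨b, p, hb, rfl⟩ := hv
    refine ⟨{p}, fun S hS => ⟨fun i => b i • ⟨p, hS (by simp)⟩,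
      AddSubgroup.subset_closure ⟨b, _, hb, rfl⟩, fun i => rfl⟩⟩
  | zero => exact ⟨∅, fun S _ => ⟨0, zero_mem _, fun i => rfl⟩⟩
  | add v w _ _ hv hw =>
    obtain ⟨T, hT⟩ := hv
    obtain ⟨T', hT'⟩ := hw
    refine ⟨T ∪ T', fun S hS => ?_⟩
    rw [Finset.coe_union, Set.union_subset_iff] at hS
    obtain ⟨m, hm, h⟩ := hT S hS.1
    obtain ⟨m', hm', h'⟩ := hT' S hS.2
    exact ⟨m + m', add_mem hm hm', fun i => by simp [h, h']⟩
  | neg v _ hv =>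
    obtain ⟨T, hT⟩ := hv
    refine ⟨T, fun S hS => ?_⟩
    obtain ⟨m, hm, h⟩ := hT S hS
    exact ⟨-m, neg_mem hm, fun i => by simp [h]⟩

/-- Every subset of cardinality at most `κ` of a flat module `M = A M` is contained in a submodule
`S = A S` of cardinality at most `κ` such that `S` and `M / S` are flat. -/
theorem exists_small_pure_submodule {κ : Cardinal.{u}} (hκ : ℵ₀ ≤ κ) (hA : #A ≤ κ)
    (hM : EquationallyFlat R M) (hAM : IsUnitaryModule E M) (T : Set M) (hT : #T ≤ κ) :
    ∃ S : Submodule R M, T ⊆ S ∧ #S ≤ κ ∧ EquationallyFlat R S ∧ IsUnitaryModule E S ∧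
      EquationallyFlat R (M ⧸ S) := by
  -- The set `C` collects the sum, the `A`-combination, a solution of the inhomogeneous equation
  -- with right side `∑ yᵢ` if there is one, and witnesses that a relation is trivial. All
  -- parameters lie in `A`, which keeps the bound independent of `R`.
  have key : ∀ (n : ℕ) (a : Fin n → A) (y : Fin n → M), ∃ C : Set M, C.Countable ∧
      ∑ i, y i ∈ C ∧ -∑ i, y i ∈ C ∧ ∑ i, E.toHom (a i) • y i ∈ C ∧
      ((∃ x : Fin n → M, ∑ i, y i = ∑ i, E.toHom (a i) • x i) →
        ∃ x : Fin n → M, (∀ i, x i ∈ C) ∧ ∑ i, y i = ∑ i, E.toHom (a i) • x i) ∧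
      (∑ i, E.toHom (a i) • y i = 0 → ∀ S : Submodule R M, C ⊆ S →
        ∃ y' ∈ trivialSolutions (fun i => E.toHom (a i)) S, ∀ i, (y' i : M) = y i) := by
    intro n a y
    obtain ⟨C₁, hC₁, h₁⟩ : ∃ C : Set M, C.Countable ∧
        ((∃ x : Fin n → M, ∑ i, y i = ∑ i, E.toHom (a i) • x i) →
          ∃ x : Fin n → M, (∀ i, x i ∈ C) ∧ ∑ i, y i = ∑ i, E.toHom (a i) • x i) := by
      by_cases h : ∃ x : Fin n → M, ∑ i, y i = ∑ i, E.toHom (a i) • x i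
      · obtain ⟨x, hx⟩ := h
        exact ⟨Set.range x, Set.countable_range x, fun _ => ⟨x, fun i => ⟨i, rfl⟩, hx⟩⟩
      · exact ⟨∅, Set.countable_empty, fun h' => absurd h' h⟩
    obtain ⟨C₂, hC₂, h₂⟩ : ∃ C : Set M, C.Countable ∧
        (∑ i, E.toHom (a i) • y i = 0 → ∀ S : Submodule R M, C ⊆ S →
          ∃ y' ∈ trivialSolutions (fun i => E.toHom (a i)) S, ∀ i, (y' i : M) = y i) := by
      by_cases h : ∑ i, E.toHom (a i) • y i = 0
      · obtain ⟨T, hT⟩ := trivialSolutions_exists_finset (hM n _ y h)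
        exact ⟨T, T.countable_toSet, fun _ => hT⟩
      · exact ⟨∅, Set.countable_empty, fun h' => absurd h' h⟩
    refine ⟨{∑ i, y i, -∑ i, y i, ∑ i, E.toHom (a i) • y i} ∪ C₁ ∪ C₂,
      ((Set.Finite.countable (by simp)).union hC₁).union hC₂, by simp, by simp, by simp,
      fun h => ?_, fun h S hS => h₂ h S (Set.subset_union_right.trans hS)⟩
    obtain ⟨x, hx, hx'⟩ := h₁ h
    exact ⟨x, fun i => Or.inl (Or.inr (hx i)), hx'⟩
  choose f hfc hsum hneg hsmul hsol hrel using key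
  obtain ⟨U, hTU, hU, hcl⟩ := exists_small_closed hκ hA f hfc T hT
  have h0 : (0 : M) ∈ U := by
    have := hcl 0 Fin.elim0 Fin.elim0 (fun i => i.elim0) (hsum 0 Fin.elim0 Fin.elim0)
    simpa using this
  have hadd : ∀ {x y : M}, x ∈ U → y ∈ U → x + y ∈ U := by
    intro x y hx hy
    have := hcl 2 (fun _ => 0) ![x, y] (by simp [Fin.forall_fin_two, hx, hy]) (hsum _ _ _)
    simpa using this
  have hUsum : ∀ {n : ℕ} (a : Fin n → A) (y : Fin n → M), (∀ i, y i ∈ U) →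
      ∑ i, E.toHom (a i) • y i ∈ U := fun a y hy => hcl _ a y hy (hsmul _ a y)
  have hUsol : ∀ s ∈ U, ∀ {k : ℕ} (a : Fin k → A) (x : Fin k → M),
      s = ∑ i, E.toHom (a i) • x i →
        ∃ x : Fin k → M, (∀ i, x i ∈ U) ∧ s = ∑ i, E.toHom (a i) • x i := by
    intro s hs k a x hx
    -- The right side of the equation is encoded as the sum of the tuple `(s, 0, …, 0)`; the extra
    -- unknown gets coefficient `0` and is dropped.
    have hy : ∀ i, (Fin.cons s 0 : Fin (k + 1) → M) i ∈ U :=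
      fun i => by
        refine Fin.cases ?_ (fun i => ?_) i
        · simpa using hs
        · simpa using h0
    obtain ⟨x', hx', h⟩ := hsol (k + 1) (Fin.cons 0 a) (Fin.cons s 0)
      ⟨Fin.cons 0 x, by simpa [Fin.sum_univ_succ] using hx⟩
    exact ⟨fun i => x' i.succ, fun i => hcl _ _ _ hy (hx' _),
      by simpa [Fin.sum_univ_succ] using h⟩
  let S : Submodule R M :=
    { carrier := U
      zero_mem' := h0
      add_mem' := hadd
      -- Writing `s = ∑ aᵢ xᵢ` with `xᵢ` in `U` turns `r s` into a combination with coefficients `r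
      -- aᵢ` in `A`.
      smul_mem' := by
        intro r s hs
        obtain ⟨k, a, x, hx⟩ := hAM.exists_sum s
        obtain ⟨x, hxU, rfl⟩ := hUsol s hs a x hx
        choose b hb using fun i => E.mul_left_mem r (a i)
        have := hUsum b x hxU
        simpa only [Finset.smul_sum, smul_smul, hb] using this }
  have hAS : IsUnitaryModule E S := by
    rw [isUnitaryModule_iff]
    intro s
    obtain ⟨k, a, x, hx⟩ := hAM.exists_sum (s : M)
    obtain ⟨x, hxU, hx⟩ := hUsol s s.2 a x hx
    have : s = ∑ i, E.toHom (a i) • (⟨x i, hxU i⟩ : S) := Subtype.ext (by simpa using hx)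
    rw [this]
    exact sum_mem fun i _ => smul_mem_unitaryPart E _ _
  refine ⟨S, hTU, hU, ?_, hAS, ?_⟩
  -- Expanding `s = a y` inside `S` gives a relation on `y` with coefficients `c = r a` over `A`. It
  -- is trivial in `S` by closure, and `trivialSolutions_matrix` carries this back to `s`.
  · intro n r s hs
    obtain ⟨k, a, y, hy⟩ := hAS.exists_matrix s
    choose c hc using fun i j => E.mul_left_mem (r i) (a i j)
    obtain ⟨y', hy', hyy⟩ := hrel k (fun j => ∑ i, c i j) (fun j => y j) (by
      have := congrArg Subtype.val hs
      simp only [hy, Finset.smul_sum, smul_smul, ← hc] at this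
      rw [Finset.sum_comm] at this
      simpa [Finset.sum_smul] using this) S (hcl _ _ _ fun j => (y j).2)
    obtain rfl : y' = y := funext fun j => Subtype.ext (hyy j)
    have := trivialSolutions_matrix (r := r) (fun i j => E.toHom (a i j))
      (fun j => by simp [hc]) hy'
    rwa [← funext hy] at this
  -- Lift to `m = a y` with `∑ rᵢ mᵢ` in `S`. The resulting equation over `A` also has a solution
  -- `y'` in `S`; then `m - a y'` satisfies the homogeneous relation in `M` and has the same image
  -- modulo `S`.
  · intro n r x hx
    choose m hm using fun i => Submodule.mkQ_surjective S (x i)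
    obtain rfl : (fun i => S.mkQ (m i)) = x := funext hm
    simp only [← map_smul, ← map_sum] at hx
    rw [Submodule.mkQ_apply, Submodule.Quotient.mk_eq_zero] at hx
    obtain ⟨k, a, y, hy⟩ := hAM.exists_matrix m
    choose c hc using fun i j => E.mul_left_mem (r i) (a i j)
    obtain ⟨y', hy', hyy⟩ := hUsol _ hx (fun j => ∑ i, c i j) y (by
      simp only [hy, Finset.smul_sum, smul_smul, ← hc]
      rw [Finset.sum_comm]
      simp [Finset.sum_smul])
    have hflat := hM n r (fun i => m i - ∑ j, E.toHom (a i j) • y' j) (by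
      simp only [smul_sub, Finset.sum_sub_distrib, Finset.smul_sum, smul_smul, ← hc]
      rw [hyy, sub_eq_zero, Finset.sum_comm]
      simp [Finset.sum_smul])
    have := trivialSolutions_map S.mkQ hflat
    convert! this using 2 with i
    rw [map_sub, eq_comm, sub_eq_self, Submodule.mkQ_apply, Submodule.Quotient.mk_eq_zero]
    exact sum_mem fun j _ => S.smul_mem _ (hy' j)

end Deconstruction

/-! ### Flat covers of modules with `Z = A Z`. -/

section Telescope

variable {A : Type u} [NonUnitalRing A] {R : Type u} [Ring R] (E : UnitalExtension A R)

/-- A direct limit along `ℕ` of equationally flat modules is equationally flat. -/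
theorem EquationallyFlat.directLimit (G : ℕ → Type u) [∀ i, AddCommGroup (G i)]
    [∀ i, Module R (G i)] (f : ∀ i j, i ≤ j → G i →ₗ[R] G j)
    [DirectedSystem G fun i j h => f i j h] (hG : ∀ i, EquationallyFlat R (G i)) :
    EquationallyFlat R (Module.DirectLimit G f) := by
  intro n r m hm
  choose k y hy using fun i => Module.DirectLimit.exists_of (m i)
  let N := Finset.univ.sup k
  have hN : ∀ i, k i ≤ N := fun i => Finset.le_sup (Finset.mem_univ i)
  have hmN : m = fun i => Module.DirectLimit.of R ℕ G f N (f _ _ (hN i) (y i)) :=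
    funext fun i => by rw [Module.DirectLimit.of_f, hy]
  rw [hmN] at hm
  simp only [← map_smul, ← map_sum] at hm
  obtain ⟨j, hj, h0⟩ := Module.DirectLimit.of.zero_exact hm
  simp only [map_sum, map_smul] at h0
  have := trivialSolutions_map (Module.DirectLimit.of R ℕ G f j) (hG j n r _ h0)
  simp only [Module.DirectLimit.of_f] at this
  simpa only [hmN, Module.DirectLimit.of_f] using this

variable {E} in
/-- Every module `Z = A Z` is a quotient of a flat module `F = A F`. -/
theorem IsUnitaryModule.exists_flat_surjection {Z : Type u} [AddCommGroup Z] [Module R Z]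
    (hZ : IsUnitaryModule E Z) : ∃ (F : ModuleCat.{u} R) (p : F →ₗ[R] Z),
      Function.Surjective p ∧ EquationallyFlat R F ∧ IsUnitaryModule E F := by
  choose k a y hy using hZ.exists_sum
  -- The endomorphism `φ` lifts the expansions `z = ∑ aⱼ yⱼ` to the free module. The limit of the
  -- telescope `φ, φ, …` is flat, still maps onto `Z` because `π φ = π`, and equals `A` times itself
  -- because moving an element one stage up lands it in `A` times the free module.
  let φ : (Z →₀ R) →ₗ[R] (Z →₀ R) := Finsupp.linearCombination R
    fun z => ∑ j, E.toHom (a z j) • Finsupp.single (y z j) (1 : R)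
  let π : (Z →₀ R) →ₗ[R] Z := Finsupp.linearCombination R id
  have hφ : ∀ x, π (φ x) = π x := by
    intro x
    refine LinearMap.congr_fun (f := π ∘ₗ φ) (g := π) (Finsupp.lhom_ext' fun z =>
      LinearMap.ext_ring ?_) x
    simp [φ, π, ← hy]
  have hπ : ∀ n x, π ((φ ^ n) x) = π x := by
    intro n
    induction n with
    | zero => intro x; rfl
    | succ n ih => intro x; rw [pow_succ, Module.End.mul_apply, ih, hφ]
  let f : ∀ i j : ℕ, i ≤ j → (Z →₀ R) →ₗ[R] (Z →₀ R) := fun i j _ => φ ^ (j - i)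
  have : DirectedSystem (fun _ : ℕ => Z →₀ R) fun i j h => f i j h :=
    { map_self := fun i x => by simp [f]
      map_map := fun k j i hij hjk x => by
        simp only [f, ← Module.End.mul_apply, ← pow_add]
        congr 2
        omega }
  refine ⟨ModuleCat.of R (Module.DirectLimit (fun _ : ℕ => Z →₀ R) f),
    Module.DirectLimit.lift R ℕ _ f (fun _ => π) fun i j h x => hπ _ x, fun z => ?_,
    EquationallyFlat.directLimit _ f fun _ => EquationallyFlat.finsupp Z, ?_⟩
  · exact ⟨Module.DirectLimit.of R ℕ _ f 0 (Finsupp.single z 1), by simp [π]⟩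
  · rw [isUnitaryModule_iff]
    intro x
    obtain ⟨n, x, rfl⟩ := Module.DirectLimit.exists_of x
    rw [← Module.DirectLimit.of_f (hij := Nat.le_succ n)]
    have hf : f n n.succ n.le_succ = φ := by simp [f]
    rw [hf]
    induction x using Finsupp.induction_linear with
    | zero => simp
    | add x y hx hy => rw [map_add, map_add]; exact add_mem hx hy
    | single z r =>
      simp only [φ, Finsupp.linearCombination_single, map_smul, map_sum]
      exact Submodule.smul_mem _ _ (sum_mem fun j _ => smul_mem_unitaryPart E _ _)

end Telescope

/-! ### The small object argument and tests by lifting. -/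

section SmallObject

variable {R : Type u} [Ring R]

/-- The inclusions of submodules `K i ⊆ L i`. -/
abbrev submoduleInclusions {ι : Type u} (L : ι → ModuleCat.{u} R) (K : ∀ i, Submodule R (L i)) :
    MorphismProperty (ModuleCat.{u} R) :=
  MorphismProperty.ofHoms fun i =>
    (ModuleCat.ofHom (K i).subtype : ModuleCat.of R (K i) ⟶ L i)

variable {ι : Type u} (L : ι → ModuleCat.{u} R) (K : ∀ i, Submodule R (L i))

theorem submoduleInclusions_le_monomorphisms :
    submoduleInclusions L K ≤ MorphismProperty.monomorphisms _ := by
  rintro _ _ _ ⟨i⟩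
  exact (ModuleCat.mono_iff_injective _).2 (Submodule.injective_subtype _)

-- The transfinite compositions involved consist of monomorphisms. In a Grothendieck abelian
-- category, `Hom(K i, -)` commutes with such compositions once their length is a regular cardinal
-- exceeding the number of subobjects of `K i`.
open MorphismProperty in
instance hasSmallObjectArgument_submoduleInclusions :
    HasSmallObjectArgument.{u} (submoduleInclusions L K) := by
  obtain ⟨κ, hκ', hκ⟩ := HasCardinalLT.exists_regular_cardinal.{u}
    (Σ i, Shrink.{u} (Subobject (ModuleCat.of R (K i))))
  have : Fact κ.IsRegular := ⟨hκ'⟩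
  have : Nonempty κ.ord.ToType := by simpa using hκ'.ne_zero
  have := WellFoundedLT.toOrderBot κ.ord.ToType
  exact ⟨κ, inferInstance, inferInstance,
    { preservesColimit {A B X Y} i hi f hf := by
        let hf' : (monomorphisms (ModuleCat.{u} R)).TransfiniteCompositionOfShape κ.ord.ToType f :=
          { toTransfiniteCompositionOfShape := hf.toTransfiniteCompositionOfShape
            map_mem j hj := by
              have := (hf.attachCells j hj).pushouts_coproducts
              simp only [ofHoms_homFamily] at this
              refine (?_ : _ ≤ monomorphisms _) _ this
              rw [pushouts_le_iff]
              exact (coproducts_monotone (submoduleInclusions_le_monomorphisms L K)).trans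
                (coproducts_le _) }
        have (j j' : κ.ord.ToType) (φ : j ⟶ j') : Mono (hf'.F.map φ) := hf'.mem_map φ
        apply IsGrothendieckAbelian.preservesColimit_coyoneda_obj_of_mono (Y := hf'.F) (κ := κ)
        obtain ⟨i⟩ := hi
        exact hκ.of_injective (fun s => ⟨i, equivShrink _ s⟩) fun s t h =>
          (equivShrink _).injective (by simpa using h) }⟩

theorem submoduleInclusions_rlp_iff {X Y : ModuleCat.{u} R} (p : X ⟶ Y) :
    (submoduleInclusions L K).rlp p ↔ ∀ (i : ι) (f : K i →ₗ[R] X) (g : L i →ₗ[R] Y),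
      (∀ x : K i, p.hom (f x) = g x) →
        ∃ w : L i →ₗ[R] X, (∀ x : K i, w x = f x) ∧ ∀ x, p.hom (w x) = g x := by
  constructor
  · intro hp i f g h
    have := hp _ ⟨i⟩
    have sq : CommSq (ModuleCat.ofHom f) (ModuleCat.ofHom (K i).subtype) p (ModuleCat.ofHom g) :=
      ⟨ModuleCat.hom_ext (LinearMap.ext h)⟩
    exact ⟨sq.lift.hom, fun x => congrArg (fun φ => φ.hom x) sq.fac_left,
      fun x => congrArg (fun φ => φ.hom x) sq.fac_right⟩
  · rintro h _ _ _ ⟨i⟩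
    refine ⟨fun {f g} sq => ?_⟩
    obtain ⟨w, hw, hw'⟩ := h i f.hom g.hom fun x => congrArg (fun φ => φ.hom x) sq.w
    exact ⟨⟨⟨ModuleCat.ofHom w, ModuleCat.hom_ext (LinearMap.ext hw),
      ModuleCat.hom_ext (LinearMap.ext hw')⟩⟩⟩

/-- If `L / K` is flat and `f : X → Y` is injective, then `Y* → X*` has the right lifting property
with respect to `K → L`. -/
theorem exists_lift_charDual {L : Type u} [AddCommGroup L] [Module R L] (K : Submodule R L)
    (hK : EquationallyFlat R (L ⧸ K)) {X Y : Type u} [AddCommGroup X] [Module Rᵐᵒᵖ X]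
    [AddCommGroup Y] [Module Rᵐᵒᵖ Y] (f : X →ₗ[Rᵐᵒᵖ] Y) (hf : Function.Injective f)
    (φ : K →ₗ[R] CharacterModule Y) (ψ : L →ₗ[R] CharacterModule X)
    (h : ∀ x : K, charDualLeft f (φ x) = ψ x) :
    ∃ w : L →ₗ[R] CharacterModule Y, (∀ x : K, w x = φ x) ∧ ∀ x, charDualLeft f (w x) = ψ x := by
  have := hK.injective_characterModule
  have hq : Function.Injective (charDualRight K.mkQ) := by
    intro c d hcd
    refine DFunLike.ext _ _ fun x => ?_
    obtain ⟨x, rfl⟩ := K.mkQ_surjective x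
    exact DFunLike.congr_fun hcd x
  -- As `(L / K)*` is injective, `L*` splits as `K* × (L / K)*`.
  obtain ⟨ρ, hρ⟩ := Module.Injective.extension_property Rᵐᵒᵖ _ _ _ (charDualRight K.mkQ) hq
    LinearMap.id
  have hρ' : ∀ c, ρ (charDualRight K.mkQ c) = c := LinearMap.congr_fun hρ
  have hres : ∀ c, charDualRight K.subtype (charDualRight K.mkQ c) = 0 := fun c =>
    DFunLike.ext _ _ fun x => (congrArg c ((Submodule.Quotient.mk_eq_zero K).2 x.2)).trans
      (map_zero c)
  let e₀ : CharacterModule L →ₗ[Rᵐᵒᵖ] CharacterModule K × CharacterModule (L ⧸ K) :=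
    (charDualRight K.subtype).prod ρ
  have he : Function.Bijective e₀ := by
    constructor
    · rw [injective_iff_map_eq_zero]
      intro c hc
      obtain ⟨h1, h2⟩ := Prod.ext_iff.1 hc
      let d : CharacterModule (L ⧸ K) := QuotientAddGroup.lift K.toAddSubgroup
        (c : L →+ AddCircle (1 : ℚ)) fun x hx => DFunLike.congr_fun h1 (⟨x, hx⟩ : K)
      have hd : charDualRight K.mkQ d = c := rfl
      have : d = 0 := by rw [← hρ' d, hd]; exact h2
      rw [← hd, this, map_zero]
    · rintro ⟨α, β⟩
      obtain ⟨α', hα'⟩ := exists_char_extension K.subtype.toAddMonoidHom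
        (Submodule.injective_subtype K) α
      refine ⟨α' + charDualRight K.mkQ (β - ρ α'), Prod.ext ?_ ?_⟩
      · change charDualRight K.subtype _ = α
        rw [map_add, hres, add_zero]
        exact DFunLike.ext _ _ hα'
      · change ρ _ = β
        rw [map_add, hρ', add_sub_cancel]
  let e := LinearEquiv.ofBijective e₀ he
  -- After transposition, a map `X → L*` has to be extended along `f`. Its component in `K*` is
  -- prescribed by `φ`; the other one extends by injectivity.
  obtain ⟨τ, hτ⟩ := Module.Injective.extension_property Rᵐᵒᵖ _ _ _ f hf (ρ ∘ₗ transposeRight ψ)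
  let w : Y →ₗ[Rᵐᵒᵖ] CharacterModule L := e.symm.toLinearMap ∘ₗ (transposeRight φ).prod τ
  have hw : ∀ y, e (w y) = (transposeRight φ y, τ y) := fun y => e.apply_symm_apply _
  refine ⟨transposeLeft w, fun x => DFunLike.ext _ _ fun y => ?_, fun x =>
    DFunLike.ext _ _ fun y => ?_⟩
  · exact DFunLike.congr_fun (congrArg Prod.fst (hw y)) x
  · have : w (f y) = transposeRight ψ y := by
      apply e.injective
      rw [hw]
      refine Prod.ext ?_ ?_
      · exact DFunLike.ext _ _ fun k => DFunLike.congr_fun (h k) y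
      · exact LinearMap.congr_fun hτ y
    exact DFunLike.congr_fun this x

/-- Homomorphisms from a module `M = A M` to a module annihilated by `A` vanish. -/
theorem IsUnitaryModule.hom_eq_zero {A : Type u} [NonUnitalRing A] {E : UnitalExtension A R}
    {M D : Type u} [AddCommGroup M] [Module R M] [AddCommGroup D] [Module R D]
    (hM : IsUnitaryModule E M) (hD : ∀ (a : A) (d : D), E.toHom a • d = 0) (g : M →ₗ[R] D) :
    g = 0 := by
  ext m
  obtain ⟨k, a, y, rfl⟩ := hM.exists_sum m
  simp [hD]

/-- The small object argument for a set of inclusions with flat cokernels `S = A S`. -/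
theorem exists_factorization {A : Type u} [NonUnitalRing A] (E : UnitalExtension A R)
    (hflat : ∀ i, EquationallyFlat R (L i ⧸ K i)) (hA : ∀ i, IsUnitaryModule E (L i ⧸ K i))
    {Y Z : ModuleCat.{u} R} (f : Y ⟶ Z) :
    ∃ (C : ModuleCat.{u} R) (i : Y ⟶ C) (p : C ⟶ Z), i ≫ p = f ∧ Function.Injective i.hom ∧
      EquationallyFlat R (C ⧸ LinearMap.range i.hom) ∧
      IsUnitaryModule E (C ⧸ LinearMap.range i.hom) ∧
      ∀ (j : ι) (φ : K j →ₗ[R] C) (ψ : L j →ₗ[R] Z), (∀ x : K j, p.hom (φ x) = ψ x) →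
        ∃ w : L j →ₗ[R] C, (∀ x : K j, w x = φ x) ∧ ∀ x, p.hom (w x) = ψ x := by
  let I := submoduleInclusions L K
  let D := MorphismProperty.factorizationData I.rlp.llp I.rlp f
  have llp : ∀ {X W : ModuleCat.{u} R} (q : X ⟶ W), I.rlp q →
      ∀ (a : Y ⟶ X) (b : D.Z ⟶ W), a ≫ q = D.i ≫ b → ∃ w : D.Z ⟶ X, D.i ≫ w = a ∧ w ≫ q = b := by
    intro X W q hq a b h
    have := D.hi q hq
    have sq : CommSq a D.i q b := ⟨h⟩
    exact ⟨sq.lift, sq.fac_left, sq.fac_right⟩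
  -- Lifting with the zero map on `Y` shows that maps out of the cokernel lift through every `q`
  -- with the right lifting property. Suitable choices of `q` then reveal the structure of this
  -- cokernel.
  have coker : ∀ {X W : ModuleCat.{u} R} (q : X ⟶ W), I.rlp q →
      ∀ (b : (D.Z ⧸ LinearMap.range D.i.hom) →ₗ[R] W),
        ∃ w : (D.Z ⧸ LinearMap.range D.i.hom) →ₗ[R] X, q.hom ∘ₗ w = b := by
    intro X W q hq b
    obtain ⟨w, hw, hw'⟩ := llp q hq 0 (ModuleCat.ofHom (b ∘ₗ (LinearMap.range D.i.hom).mkQ)) (by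
      ext y
      have : (LinearMap.range D.i.hom).mkQ (D.i.hom y) = 0 :=
        (Submodule.Quotient.mk_eq_zero _).2 ⟨y, rfl⟩
      simp [this])
    refine ⟨(LinearMap.range D.i.hom).liftQ w.hom ?_, ?_⟩
    · rintro _ ⟨y, rfl⟩
      exact congrArg (fun φ => φ.hom y) hw
    · ext x
      exact congrArg (fun φ => φ.hom x) hw'
  refine ⟨D.Z, D.i, D.p, D.fac, ?_, ?_, ?_, (submoduleInclusions_rlp_iff L K D.p).1 D.hp⟩
  -- An injective hull-like embedding of `Y` into an injective module extends along `D.i`, so `D.i`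
  -- is injective.
  · have hq : I.rlp (0 : Injective.under Y ⟶ ModuleCat.of R PUnit.{u + 1}) := by
      rintro _ _ g ⟨i⟩
      have : Mono (ModuleCat.ofHom (K i).subtype : ModuleCat.of R (K i) ⟶ L i) :=
        submoduleInclusions_le_monomorphisms L K _ ⟨i⟩
      refine ⟨fun {a b} sq => ⟨⟨⟨Injective.factorThru a _, Injective.comp_factorThru _ _, ?_⟩⟩⟩⟩
      exact (ModuleCat.isZero_of_subsingleton _).eq_of_tgt _ _
    obtain ⟨w, hw, -⟩ := llp _ hq (Injective.ι Y) 0 ((ModuleCat.isZero_of_subsingleton _).eq_of_tgt _ _)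
    have : Mono (D.i ≫ w) := by rw [hw]; infer_instance
    have := mono_of_mono D.i w
    exact (ModuleCat.mono_iff_injective _).1 this
  · refine IsFlatModule.equationallyFlat (M := ModuleCat.of R (D.Z ⧸ LinearMap.range D.i.hom)) ?_
    intro X Y f hf
    -- Lifting through `Y* → X*` extends characters of `X ⊗ F` to `Y ⊗ F`, where `F` is the
    -- cokernel; this is flatness.
    have hq : I.rlp (ModuleCat.ofHom (charDualLeft f.hom) :
        ModuleCat.of R (CharacterModule Y) ⟶ ModuleCat.of R (CharacterModule X)) := by
      rw [submoduleInclusions_rlp_iff]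
      exact fun i φ ψ h => exists_lift_charDual (K i) (hflat i) f.hom hf φ ψ h
    rw [injective_iff_map_eq_zero]
    intro t ht
    by_contra h
    obtain ⟨χ, -, hχ⟩ := exists_char_separating (⊥ : AddSubgroup (BalancedTensor R X _)) (t := t) h
    obtain ⟨w, hw⟩ := coker _ hq (transposeLeft (curryRight χ))
    have := balancedTensor_hom_congr
      (AddMonoidHom.comp (charOfRight (transposeRight w)) (balancedMap f.hom _)) χ
      (fun x m => DFunLike.congr_fun (LinearMap.congr_fun hw m) x) t
    exact hχ (this.symm.trans
      ((congrArg (charOfRight (transposeRight w)) ht).trans (map_zero _)))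
  · let F := D.Z ⧸ LinearMap.range D.i.hom
    have hD : ∀ (a : A) (d : F ⧸ unitaryPart E F), E.toHom a • d = 0 := by
      intro a d
      obtain ⟨d, rfl⟩ := Submodule.mkQ_surjective _ d
      rw [← map_smul]
      exact (Submodule.Quotient.mk_eq_zero _).2 (smul_mem_unitaryPart E a d)
    -- Each `L i / K i` has only zero maps to a module killed by `A`. Hence the projection `F → F /
    -- A F` lifts through `0` and must vanish.
    have hq : I.rlp (0 : ModuleCat.of R PUnit.{u + 1} ⟶ ModuleCat.of R (F ⧸ unitaryPart E F)) := by
      rw [submoduleInclusions_rlp_iff]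
      intro i φ ψ h
      refine ⟨0, fun x => Subsingleton.elim _ _, fun x => ?_⟩
      have := (hA i).hom_eq_zero hD ((K i).liftQ ψ fun x hx => (h ⟨x, hx⟩).symm)
      exact (LinearMap.congr_fun this ((K i).mkQ x)).symm
    obtain ⟨w, hw⟩ := coker _ hq (unitaryPart E F).mkQ
    rw [isUnitaryModule_iff]
    intro m
    rw [← Submodule.Quotient.mk_eq_zero]
    exact (LinearMap.congr_fun hw m).symm

end SmallObject

/-! ### Splitting of extensions and extension of homomorphisms. -/

section Extensions

variable {R : Type u} [Ring R]

/-- A quotient by the kernel of a surjection. -/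
theorem exists_quotient_equiv {X W : Type*} [AddCommGroup X] [Module R X] [AddCommGroup W]
    [Module R W] (q : X →ₗ[R] W) (hq : Function.Surjective q) (D : Submodule R X)
    (hD : ∀ x, q x = 0 ↔ x ∈ D) : Nonempty ((X ⧸ D) ≃ₗ[R] W) := by
  obtain rfl : D = LinearMap.ker q := Submodule.ext fun x => (hD x).symm
  exact ⟨q.quotKerEquivOfSurjective hq⟩

theorem EquationallyFlat.of_equiv {M N : Type*} [AddCommGroup M] [Module R M] [AddCommGroup N]
    [Module R N] (e : M ≃ₗ[R] N) (hM : EquationallyFlat R M) : EquationallyFlat R N :=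
  hM.of_retract e.symm.toLinearMap e.toLinearMap e.apply_symm_apply

/-- A homomorphism with values in the image of an injective homomorphism lifts. -/
theorem exists_lift_of_injective {C X Y : Type*} [AddCommGroup C] [Module R C] [AddCommGroup X]
    [Module R X] [AddCommGroup Y] [Module R Y] (i : C →ₗ[R] X) (hi : Function.Injective i)
    (h : Y →ₗ[R] X) (hh : ∀ y, ∃ c, i c = h y) : ∃ ρ : Y →ₗ[R] C, ∀ y, i (ρ y) = h y := by
  refine ⟨(LinearEquiv.ofInjective i hi).symm.toLinearMap ∘ₗ
    h.codRestrict (LinearMap.range i) hh, fun y => ?_⟩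
  exact congrArg Subtype.val ((LinearEquiv.ofInjective i hi).apply_symm_apply
    (h.codRestrict (LinearMap.range i) hh y))

theorem shortExact_iff {N X M : ModuleCat.{u} R} (i : N ⟶ X) (p : X ⟶ M) (w : i ≫ p = 0) :
    (ShortComplex.mk i p w).ShortExact ↔ Function.Injective i.hom ∧
      (∀ x, p.hom x = 0 → ∃ y, i.hom y = x) ∧ Function.Surjective p.hom := by
  constructor
  · intro h
    exact ⟨h.moduleCat_injective_f, (ShortComplex.moduleCat_exact_iff _).1 h.exact,
      h.moduleCat_surjective_g⟩
  · rintro ⟨h₁, h₂, h₃⟩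
    have := (ModuleCat.mono_iff_injective i).2 h₁
    have := (ModuleCat.epi_iff_surjective p).2 h₃
    exact ⟨(ShortComplex.moduleCat_exact_iff _).2 h₂⟩

/-- Every extension of `M` by `N` splits. -/
def ExtensionsSplit (M N : ModuleCat.{u} R) : Prop :=
  ∀ (X : ModuleCat.{u} R) (i : N ⟶ X) (p : X ⟶ M) (w : i ≫ p = 0),
    (ShortComplex.mk i p w).ShortExact → ∃ ρ : X ⟶ N, i ≫ ρ = 𝟙 N

/-- If the extensions of `S` by `C` split, then homomorphisms to `C` extend along injections with
cokernel `S`. -/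
theorem ExtensionsSplit.exists_extension {S C : ModuleCat.{u} R} (hSC : ExtensionsSplit S C)
    {K L : Type u} [AddCommGroup K] [Module R K] [AddCommGroup L] [Module R L] (j : K →ₗ[R] L)
    (hj : Function.Injective j) (q : L →ₗ[R] S) (hq : Function.Surjective q)
    (hjq : ∀ l, q l = 0 ↔ ∃ k, j k = l) (g : K →ₗ[R] C) :
    ∃ g' : L →ₗ[R] C, ∀ k, g' (j k) = g k := by
  -- The quotient by `D` is the pushout of `j` along `g`, an extension of `S` by `C`; a retraction
  -- onto `C`, restricted to `L`, extends `g`.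
  let D : Submodule R (C × L) := LinearMap.range (g.prod (-j))
  let i : C →ₗ[R] (C × L) ⧸ D := D.mkQ ∘ₗ LinearMap.inl R C L
  let p : ((C × L) ⧸ D) →ₗ[R] S := D.liftQ (q ∘ₗ LinearMap.snd R C L) (by
    rintro _ ⟨k, rfl⟩
    change q (-(j k)) = 0
    rw [map_neg, (hjq _).2 ⟨k, rfl⟩, neg_zero])
  have hi : Function.Injective i := by
    rw [injective_iff_map_eq_zero]
    intro c hc
    obtain ⟨k, hk⟩ := (Submodule.Quotient.mk_eq_zero D).1 hc
    obtain ⟨h₁, h₂⟩ := Prod.ext_iff.1 hk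
    have hk0 : k = 0 := hj (by rw [map_zero]; exact neg_eq_zero.1 h₂)
    rw [← show g k = c from h₁, hk0, map_zero]
  have hrel : ∀ k, D.mkQ (0, j k) = i (g k) := by
    intro k
    refine (Submodule.Quotient.eq D).2 ⟨-k, ?_⟩
    simp
  obtain ⟨ρ, hρ⟩ := hSC (ModuleCat.of R ((C × L) ⧸ D)) (ModuleCat.ofHom i) (ModuleCat.ofHom p)
    (ModuleCat.hom_ext (LinearMap.ext fun c => map_zero q)) <| by
      rw [shortExact_iff]
      refine ⟨hi, fun x hx => ?_, fun s => ?_⟩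
      · obtain ⟨⟨c, l⟩, rfl⟩ := D.mkQ_surjective x
        obtain ⟨k, rfl⟩ := (hjq l).1 hx
        refine ⟨c + g k, ?_⟩
        change i (c + g k) = _
        rw [map_add, ← hrel]
        change D.mkQ (c, 0) + _ = _
        rw [← map_add]
        simp
      · obtain ⟨l, rfl⟩ := hq s
        exact ⟨D.mkQ (0, l), rfl⟩
  refine ⟨ρ.hom ∘ₗ D.mkQ ∘ₗ LinearMap.inr R C L, fun k => ?_⟩
  exact (congrArg ρ.hom (hrel k)).trans (congrArg (fun φ => φ.hom (g k)) hρ)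

/-- If homomorphisms `K → C` extend to a free module `L ⊇ K`, then the extensions of `L / K` by `C`
split. -/
theorem ExtensionsSplit.of_exists_extension {S C : ModuleCat.{u} R} {T : Type u}
    (q : (T →₀ R) →ₗ[R] S) (hq : Function.Surjective q) (K : Submodule R (T →₀ R))
    (hK : ∀ x, q x = 0 ↔ x ∈ K)
    (h : ∀ g : K →ₗ[R] C, ∃ g' : (T →₀ R) →ₗ[R] C, ∀ k : K, g' k = g k) :
    ExtensionsSplit S C := by
  intro X i p w hS
  obtain ⟨hi, hip, hp⟩ := (shortExact_iff i p w).1 hS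
  choose lft hl using hp
  -- The lift `φ` of `q` restricts to a map `K → C`. Subtracting an extension `g'` of it makes `φ`
  -- factor through a section `σ` of `p`, and `1 - σ p` is the retraction.
  let φ : (T →₀ R) →ₗ[R] X := Finsupp.linearCombination R fun t => lft (q (Finsupp.single t 1))
  have hφ : ∀ x, p.hom (φ x) = q x := by
    intro x
    refine LinearMap.congr_fun (f := p.hom ∘ₗ φ) (g := q) (Finsupp.lhom_ext' fun t =>
      LinearMap.ext_ring ?_) x
    simp [φ, hl]
  obtain ⟨g, hg⟩ := exists_lift_of_injective (Y := K) i.hom hi (φ ∘ₗ K.subtype) fun k =>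
    hip _ ((hφ _).trans ((hK _).2 k.2))
  obtain ⟨g', hg'⟩ := h g
  obtain ⟨σ, hσ⟩ := exists_factor_of_surjective q hq (φ - i.hom ∘ₗ g') fun x hx => by
    have := hg ⟨x, (hK x).1 hx⟩
    rw [← hg'] at this
    exact sub_eq_zero.2 this.symm
  have hpi : ∀ c, p.hom (i.hom c) = 0 := fun c => congrArg (fun φ => φ.hom c) w
  have hpσ : ∀ s, p.hom (σ s) = s := by
    intro s
    obtain ⟨l, rfl⟩ := hq s
    rw [hσ, LinearMap.sub_apply, LinearMap.comp_apply, map_sub, hpi, sub_zero, hφ]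
  obtain ⟨ρ, hρ⟩ := exists_lift_of_injective i.hom hi (LinearMap.id - σ ∘ₗ p.hom) fun x =>
    hip _ (by simp [hpσ])
  refine ⟨ModuleCat.ofHom ρ, ModuleCat.hom_ext (LinearMap.ext fun c => hi ?_)⟩
  refine (hρ (i.hom c)).trans ?_
  simp [hpi]

end Extensions

/-! ### Relative extensions of h-unitary modules. -/

section RelativeExt

variable {A : Type u} [NonUnitalRing A] {R : Type u} [Ring R] (E : UnitalExtension A R)

theorem HUnitary.of_shortExact {N X M : ModuleCat.{u} R} {i : N ⟶ X} {p : X ⟶ M} {w : i ≫ p = 0}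
    (h : (ShortComplex.mk i p w).ShortExact) (hN : HUnitary E N) (hM : HUnitary E M) :
    HUnitary E X := by
  obtain ⟨hi, hip, hp⟩ := (shortExact_iff i p w).1 h
  refine HUnitary.extension E i.hom p.hom hi (fun x => ⟨hip x, ?_⟩) hp hN hM
  rintro ⟨y, rfl⟩
  exact congrArg (fun φ => φ.hom y) w

theorem HUnitary.of_shortExact_left {N X M : ModuleCat.{u} R} {i : N ⟶ X} {p : X ⟶ M}
    {w : i ≫ p = 0} (h : (ShortComplex.mk i p w).ShortExact) (hX : HUnitary E X)
    (hM : HUnitary E M) : HUnitary E N := by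
  obtain ⟨hi, hip, hp⟩ := (shortExact_iff i p w).1 h
  refine HUnitary.kernel E i.hom p.hom hi (fun x => ⟨hip x, ?_⟩) hp hX hM
  rintro ⟨y, rfl⟩
  exact congrArg (fun φ => φ.hom y) w

/-- Closure under extensions makes every extension of `M` by `N` a proper one. Congruence with the
biproduct yields a retraction; conversely, a retraction of one extension and a section of another
combine to a congruence. -/
theorem relExt1Vanishes_iff {M N : ModuleCat.{u} R} (hM : HUnitary E M) (hN : HUnitary E N) :
    RelExt1Vanishes (HUnitary E) M N ↔ ExtensionsSplit M N := by
  constructor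
  · intro h X i p w hS
    have hB := (ShortComplex.Splitting.ofHasBinaryBiproduct N M).shortExact
    let ξ : ProperExtension (HUnitary E) M N := ⟨X, HUnitary.of_shortExact E hS hN hM, i, p, w, hS⟩
    let η : ProperExtension (HUnitary E) M N :=
      ⟨_, HUnitary.of_shortExact E hB hN hM, _, _, _, hB⟩
    obtain ⟨e, he, -⟩ := Quotient.exact (h.elim (Quotient.mk _ ξ) (Quotient.mk _ η))
    refine ⟨e.hom ≫ Limits.biprod.fst, ?_⟩
    rw [← Category.assoc]
    exact (congrArg (· ≫ Limits.biprod.fst) he).trans Limits.biprod.inl_fst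
  · intro h
    refine ⟨fun x y => ?_⟩
    induction x, y using Quotient.inductionOn₂ with
    | h ξ η =>
      apply Quotient.sound
      obtain ⟨r, hr⟩ := h ξ.X ξ.i ξ.p ξ.w ξ.shortExact
      obtain ⟨t, ht⟩ := h η.X η.i η.p η.w η.shortExact
      have := η.shortExact.epi_g
      let s := ShortComplex.Splitting.ofExactOfRetraction _ η.shortExact.exact t ht this
      have hsg : s.s ≫ η.p = 𝟙 _ := s.s_g
      let φ : ShortComplex.mk ξ.i ξ.p ξ.w ⟶ ShortComplex.mk η.i η.p η.w :=
        { τ₁ := 𝟙 _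
          τ₂ := r ≫ η.i + ξ.p ≫ s.s
          τ₃ := 𝟙 _
          comm₁₂ := by simp [reassoc_of% hr, reassoc_of% ξ.w]
          comm₂₃ := by simp [η.w, hsg] }
      have : IsIso φ.τ₁ := inferInstanceAs (IsIso (𝟙 _))
      have : IsIso φ.τ₃ := inferInstanceAs (IsIso (𝟙 _))
      have := ShortComplex.isIso₂_of_shortExact_of_isIso₁₃ φ ξ.shortExact η.shortExact
      exact ⟨asIso φ.τ₂, φ.comm₁₂.symm.trans (Category.id_comp _),
        φ.comm₂₃.trans (Category.comp_id _)⟩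

end RelativeExt

/-! ### Small flat modules: test family, Eklof's lemma and filtrations. -/

section Small

variable {A : Type u} [NonUnitalRing A] {R : Type u} [Ring R] (E : UnitalExtension A R)

/-- The modules of bounded cardinality form a set up to isomorphism. -/
theorem essentiallySmall_of_card_le (κ : Cardinal.{u}) (P : ObjectProperty (ModuleCat.{u} R))
    (hP : ∀ M, P M → #M ≤ κ) : ObjectProperty.EssentiallySmall.{u} P := by
  let J := Σ (s : Set κ.out) (_ : AddCommGroup s), Module R s
  let obj : J → ModuleCat.{u} R := fun j =>
    @ModuleCat.of R _ j.1 j.2.1 j.2.2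
  refine ⟨ObjectProperty.ofObj obj, inferInstance, fun M hM => ?_⟩
  obtain ⟨f⟩ : Nonempty (M ↪ κ.out) := by
    rw [← Cardinal.le_def, Cardinal.mk_out]
    exact hP M hM
  let e : Set.range f ≃ M := (Equiv.ofInjective f f.injective).symm
  let _ : AddCommGroup (Set.range f) := e.addCommGroup
  let _ : Module R (Set.range f) := e.module R
  exact ⟨_, ⟨(⟨Set.range f, inferInstance, inferInstance⟩ : J)⟩,
    ⟨(e.linearEquiv R).symm.toModuleIso⟩⟩

theorem SmallHUnitaryFlat.essentiallySmall (κ : Cardinal.{u}) :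
    ObjectProperty.EssentiallySmall.{u} (SmallHUnitaryFlat E κ) :=
  essentiallySmall_of_card_le κ _ fun _ h => h.2

/-- A set of inclusions `K → L` that tests membership in the right orthogonal of the small h-unitary
flat modules. -/
theorem exists_test_family (κ : Cardinal.{u}) : ∃ (ι : Type u) (L : ι → ModuleCat.{u} R)
    (K : ∀ i, Submodule R (L i)), (∀ i, EquationallyFlat R (L i ⧸ K i)) ∧
      (∀ i, IsUnitaryModule E (L i ⧸ K i)) ∧
      ∀ N : ModuleCat.{u} R, HUnitary E N →
        (∀ i (g : K i →ₗ[R] N), ∃ g' : L i →ₗ[R] N, ∀ k : K i, g' k = g k) →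
          rightOrth (HUnitary E) (SmallHUnitaryFlat E κ) N := by
  have := SmallHUnitaryFlat.essentiallySmall E κ
  obtain ⟨Q, hQ, hle, hiso⟩ :=
    ObjectProperty.EssentiallySmall.exists_small_le.{u} (SmallHUnitaryFlat E κ)
  have : Small.{u} (Subtype Q) := hQ
  let S : Shrink.{u} (Subtype Q) → ModuleCat.{u} R := fun i => ((equivShrink _).symm i).1
  have hS : ∀ i, HUnitaryFlat E (S i) := fun i => (hle _ ((equivShrink _).symm i).2).1
  -- The test inclusions are the kernels of free presentations of representatives `S i`.
  let q (i) : (S i →₀ R) →ₗ[R] S i := Finsupp.linearCombination R id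
  have hq : ∀ i, Function.Surjective (q i) := fun i s => ⟨Finsupp.single s 1, by simp [q]⟩
  have e : ∀ i, Nonempty (((S i →₀ R) ⧸ LinearMap.ker (q i)) ≃ₗ[R] S i) := fun i =>
    ⟨(q i).quotKerEquivOfSurjective (hq i)⟩
  refine ⟨_, fun i => ModuleCat.of R (S i →₀ R), fun i => LinearMap.ker (q i), fun i => ?_,
    fun i => ?_, fun N hN h => ⟨hN, fun D hD => ?_⟩⟩
  · exact ((hUnitaryFlat_iff E _).1 (hS i)).1.of_equiv (e i).some.symm
  · exact ((hUnitaryFlat_iff E _).1 (hS i)).2.of_surjective E _ (e i).some.symm.surjective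
  · rw [relExt1Vanishes_iff E hD.1.1 hN]
    obtain ⟨D', hD', ⟨f⟩⟩ := hiso D hD
    obtain ⟨i, rfl⟩ : ∃ i, S i = D' := ⟨equivShrink _ ⟨D', hD'⟩, by simp [S]⟩
    refine ExtensionsSplit.of_exists_extension (f.toLinearEquiv.symm.toLinearMap ∘ₗ q i)
      (f.toLinearEquiv.symm.surjective.comp (hq i)) (LinearMap.ker (q i)) (fun x => ?_) (h i)
    exact map_eq_zero_iff _ f.toLinearEquiv.symm.injective

/-- One step of a filtration by small h-unitary flat modules. -/
theorem exists_filtration_step {κ : Cardinal.{u}} (hκ : ℵ₀ ≤ κ) (hA : #A ≤ κ) {X : Type u}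
    [AddCommGroup X] [Module R X] (D : Submodule R X) (hD : EquationallyFlat R (X ⧸ D))
    (hAD : IsUnitaryModule E (X ⧸ D)) (x : X) :
    ∃ D' : Submodule R X, D ≤ D' ∧ x ∈ D' ∧ EquationallyFlat R (X ⧸ D') ∧
      ∃ (S : ModuleCat.{u} R) (q : D' →ₗ[R] S), SmallHUnitaryFlat E κ S ∧ Function.Surjective q ∧
        ∀ y, q y = 0 ↔ (y : X) ∈ D := by
  obtain ⟨S, hS, hc, h₁, h₂, h₃⟩ := exists_small_pure_submodule E hκ hA hD hAD {D.mkQ x} (by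
    simpa using Cardinal.one_le_aleph0.trans hκ)
  refine ⟨S.comap D.mkQ, fun y hy => ?_, hS rfl, ?_, ModuleCat.of R S,
    (D.mkQ ∘ₗ (S.comap D.mkQ).subtype).codRestrict S fun y => y.2,
    ⟨(hUnitaryFlat_iff E _).2 ⟨h₁, h₂⟩, hc⟩, ?_, fun y => ?_⟩
  · rw [Submodule.mem_comap, Submodule.mkQ_apply, (Submodule.Quotient.mk_eq_zero D).2 hy]
    exact zero_mem S
  · obtain ⟨e⟩ := exists_quotient_equiv (S.mkQ ∘ₗ D.mkQ)
      (S.mkQ_surjective.comp D.mkQ_surjective) (S.comap D.mkQ) fun y =>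
        Submodule.Quotient.mk_eq_zero S
    exact h₃.of_equiv e.symm
  · rintro ⟨s, hs⟩
    obtain ⟨y, rfl⟩ := D.mkQ_surjective s
    exact ⟨⟨y, hs⟩, rfl⟩
  · rw [← Submodule.Quotient.mk_eq_zero D]
    exact Subtype.ext_iff

/-- Eklof's lemma for the small h-unitary flat modules. -/
theorem extensionsSplit_of_rightOrth_small {κ : Cardinal.{u}} (hκ : ℵ₀ ≤ κ) (hA : #A ≤ κ)
    {C : ModuleCat.{u} R} (hC : rightOrth (HUnitary E) (SmallHUnitaryFlat E κ) C)
    {F : ModuleCat.{u} R} (hF : HUnitaryFlat E F) : ExtensionsSplit F C := by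
  intro X i p w hS
  obtain ⟨hi, hip, hp⟩ := (shortExact_iff i p w).1 hS
  obtain ⟨hF₁, hF₂⟩ := (hUnitaryFlat_iff E F).1 hF
  obtain ⟨e⟩ := exists_quotient_equiv p.hom hp (LinearMap.range i.hom) fun x =>
    ⟨hip x, by rintro ⟨c, rfl⟩; exact congrArg (fun φ => φ.hom c) w⟩
  -- Zorn's lemma is applied to partial retractions onto `C`. Flatness of `X / g.domain` survives
  -- unions of chains and allows one more small step whenever the domain is not all of `X`.
  let s : Set (X →ₗ.[R] C) := {g | EquationallyFlat R (X ⧸ g.domain) ∧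
    ∀ c, ∃ h : i.hom c ∈ g.domain, g ⟨i.hom c, h⟩ = c}
  let ei := LinearEquiv.ofInjective i.hom hi
  let g₀ : X →ₗ.[R] C := ⟨LinearMap.range i.hom, ei.symm.toLinearMap⟩
  have hg₀ : g₀ ∈ s := ⟨hF₁.of_equiv e.symm, fun c => ⟨⟨c, rfl⟩, ei.symm_apply_apply c⟩⟩
  obtain ⟨g, -, hg⟩ := zorn_le_nonempty₀ s (fun c hcs hc y hy => by
    have hdir : DirectedOn (· ≤ ·) c := hc.directedOn
    refine ⟨LinearPMap.sSup c hdir, ⟨?_, fun z => ?_⟩, fun z hz => LinearPMap.le_sSup hdir hz⟩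
    · have hdom : (LinearPMap.sSup c hdir).domain = ⨆ g : c, g.1.domain := by
        rw [LinearPMap.domain_sSup, sSup_image']
      have : Nonempty c := ⟨⟨y, hy⟩⟩
      rw [hdom]
      refine EquationallyFlat.quotient_iSup _ ?_ fun g => (hcs g.2).1
      intro a b
      obtain ⟨d, hd, had, hbd⟩ := hdir a a.2 b b.2
      exact ⟨⟨d, hd⟩, had.1, hbd.1⟩
    · obtain ⟨h, h'⟩ := (hcs hy).2 z
      have hle := LinearPMap.le_sSup hdir hy
      exact ⟨hle.1 h, (hle.2 rfl).symm.trans h'⟩) g₀ hg₀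
  have htop : ∀ x, x ∈ g.domain := by
    intro x
    have hle : LinearMap.range i.hom ≤ g.domain := by
      rintro _ ⟨c, rfl⟩
      exact (hg.prop.2 c).1
    have hAg : IsUnitaryModule E (X ⧸ g.domain) :=
      (hF₂.of_surjective E _ e.symm.surjective).of_surjective E (Submodule.factor hle)
        (Submodule.factor_surjective hle)
    obtain ⟨D', hD, hx, hflat, S, q, hS, hq, hqD⟩ :=
      exists_filtration_step E hκ hA g.domain hg.prop.1 hAg x
    have hsplit := (relExt1Vanishes_iff E hS.1.1 hC.1).1 (hC.2 S hS)
    obtain ⟨g', hg'⟩ := hsplit.exists_extension (Submodule.inclusion hD)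
      (Submodule.inclusion_injective hD) q hq (fun l => by
        rw [hqD]
        exact ⟨fun h => ⟨⟨l, h⟩, rfl⟩, by rintro ⟨k, rfl⟩; exact k.2⟩) g.toFun
    have hgg' : g ≤ ⟨D', g'⟩ := ⟨hD, fun {a b} hab => by
      have : b = Submodule.inclusion hD a := Subtype.ext hab.symm
      rw [this]
      exact (hg' a).symm⟩
    have : (⟨D', g'⟩ : X →ₗ.[R] C) ∈ s := ⟨hflat, fun c => by
      obtain ⟨h, h'⟩ := hg.prop.2 c
      exact ⟨hD h, (hgg'.2 rfl).symm.trans h'⟩⟩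
    exact (hg.le_of_ge this hgg').1 hx
  refine ⟨ModuleCat.ofHom (g.toFun ∘ₗ LinearMap.id.codRestrict g.domain htop),
    ModuleCat.hom_ext (LinearMap.ext fun c => ?_)⟩
  obtain ⟨h, h'⟩ := hg.prop.2 c
  exact h'

theorem cogenerates_small {κ : Cardinal.{u}} (hκ : ℵ₀ ≤ κ) (hA : #A ≤ κ) :
    Cogenerates (HUnitary E) (SmallHUnitaryFlat E κ) (HUnitaryFlat E) := by
  refine ⟨fun M h => h.1, funext fun C => propext ⟨fun hC => ⟨hC.1, fun F hF => ?_⟩,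
    fun hC => ⟨hC.1, fun F hF => hC.2 F hF.1⟩⟩⟩
  rw [relExt1Vanishes_iff E hF.1 hC.1]
  exact extensionsSplit_of_rightOrth_small E hκ hA hC hF

/-- Every h-unitary flat module is filtered by small ones. -/
theorem isFilteredBy_small {κ : Cardinal.{u}} (hκ : ℵ₀ ≤ κ) (hA : #A ≤ κ)
    {F : ModuleCat.{u} R} (hF : HUnitaryFlat E F) : IsFilteredBy (SmallHUnitaryFlat E κ) F := by
  obtain ⟨hF₁, hF₂⟩ := (hUnitaryFlat_iff E F).1 hF
  have step : ∀ N : Submodule R F, ∃ N' : Submodule R F, N ≤ N' ∧ (N ≠ ⊤ → N ≠ N') ∧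
      (N ≠ ⊤ → EquationallyFlat R (F ⧸ N) → EquationallyFlat R (F ⧸ N') ∧
        SmallHUnitaryFlat E κ (ModuleCat.of R (N' ⧸ N.submoduleOf N'))) := by
    intro N
    by_cases hN : EquationallyFlat R (F ⧸ N) ∧ N ≠ ⊤
    · obtain ⟨x, hx⟩ : ∃ x, x ∉ N := by
        by_contra! h
        exact hN.2 (eq_top_iff.2 fun x _ => h x)
      obtain ⟨N', hle, hx', hflat, S, q, ⟨hS, hSκ⟩, hq, hqN⟩ := exists_filtration_step E hκ hA N hN.1
        (hF₂.of_surjective E _ N.mkQ_surjective) x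
      refine ⟨N', hle, fun _ h => hx (h ▸ hx'), fun _ _ => ⟨hflat, ?_⟩⟩
      obtain ⟨e⟩ := exists_quotient_equiv q hq (N.submoduleOf N') hqN
      rw [hUnitaryFlat_iff] at hS
      exact ⟨(hUnitaryFlat_iff E _).2 ⟨hS.1.of_equiv e.symm,
        hS.2.of_surjective E _ e.symm.surjective⟩, (Cardinal.mk_congr e.toEquiv).trans_le hSκ⟩
    -- Where no small step is available the value `⊤` is a default; it keeps `next` strictly
    -- increasing below `⊤`.
    · exact ⟨⊤, le_top, id, fun h₁ h₂ => absurd ⟨h₂, h₁⟩ hN⟩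
  choose next hle hne hnext using step
  let X : Ordinal.{u} → Submodule R F := fun α => transfiniteIterate next α ⊥
  have hsucc : ∀ α, X (Order.succ α) = next (X α) := fun α =>
    transfiniteIterate_succ next ⊥ α (not_isMax α)
  have hlim : ∀ β, Order.IsSuccLimit β → X β = ⨆ α : Set.Iio β, X α := fun β hβ =>
    transfiniteIterate_limit next ⊥ β hβ
  have hmono : Monotone X := monotone_transfiniteIterate next ⊥ hle
  have hex : {α | X α = ⊤}.Nonempty := by
    obtain ⟨α, hα⟩ := top_mem_range_transfiniteIterate next ⊥ (J := Ordinal.{u})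
      (fun N hN => (hle N).lt_of_ne (hne N hN)) (le_antisymm le_top (hle ⊤))
      (not_injective_of_ordinal _)
    exact ⟨α, hα⟩
  -- The chain is stopped at the first ordinal reaching `⊤`, so every earlier step is a genuine one
  -- with a small quotient in `ℱ`.
  obtain ⟨l, hl, hmin⟩ := WellFounded.has_min (wellFounded_lt (α := Ordinal.{u})) _ hex
  have hflat : ∀ α ≤ l, EquationallyFlat R (F ⧸ X α) := by
    intro α
    induction α using SuccOrder.limitRecOn with
    | isMin α hα =>
      obtain rfl := hα.eq_bot
      intro _
      exact hF₁.of_equiv (Submodule.quotEquivOfEqBot (X ⊥) (transfiniteIterate_bot next ⊥)).symm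
    | succ α _ ih =>
      intro h
      have hα : α < l := (Order.lt_succ α).trans_le h
      rw [hsucc]
      exact (hnext (X α) (fun h => hmin α h hα) (ih hα.le)).1
    | isSuccLimit β hβ ih =>
      intro h
      rw [hlim β hβ]
      have : Nonempty (Set.Iio β) := ⟨⟨⊥, hβ.bot_lt⟩⟩
      exact EquationallyFlat.quotient_iSup _
        (Monotone.directed_le fun a b hab => hmono hab) fun α => ih α α.2 (α.2.le.trans h)
  refine ⟨l, X, ?_, hl, fun α _ => ?_, fun β _ hβ => hlim β hβ, fun α hα => ?_⟩
  · rw [← Ordinal.bot_eq_zero]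
    exact transfiniteIterate_bot next ⊥
  · exact hmono (Order.le_succ α)
  · have := (hnext (X α) (fun h => hmin α h hα) (hflat α hα.le)).2
    rw [← hsucc] at this
    exact this

end Small

/-! ### Completeness of the cotorsion pair. -/

section Completeness

variable {A : Type u} [NonUnitalRing A] {R : Type u} [Ring R] (E : UnitalExtension A R)

/-- In the factorization of `Y → 0` the middle term has the extension property against the test
family, and it is h-unitary as an extension of a module in `ℱ` by `Y`. -/
theorem hasEnoughInjectives_hUnitary :
    HasEnoughInjectives (HUnitary E) (HUnitaryFlat E) (HUnitaryCotorsion E) := by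
  intro Y hY
  obtain ⟨ι, L, K, h₁, h₂, h₃⟩ := exists_test_family E (max #A ℵ₀)
  obtain ⟨C, i, p, -, hi, hflat, hun, hlift⟩ := exists_factorization L K E h₁ h₂
    (0 : Y ⟶ ModuleCat.of R PUnit.{u + 1})
  have hF : HUnitaryFlat E (ModuleCat.of R (C ⧸ LinearMap.range i.hom)) :=
    (hUnitaryFlat_iff E _).2 ⟨hflat, hun⟩
  have w : i ≫ ModuleCat.ofHom (LinearMap.range i.hom).mkQ = 0 :=
    ModuleCat.hom_ext (LinearMap.ext fun y => (Submodule.Quotient.mk_eq_zero _).2 ⟨y, rfl⟩)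
  have hS : (ShortComplex.mk i (ModuleCat.ofHom (LinearMap.range i.hom).mkQ) w).ShortExact := by
    rw [shortExact_iff]
    exact ⟨hi, fun x hx => (Submodule.Quotient.mk_eq_zero _).1 hx, Submodule.mkQ_surjective _⟩
  refine ⟨C, _, i, _, w, ?_, hF, hS⟩
  have hC := h₃ C (HUnitary.of_shortExact E hS hY hF.1) fun j g => by
    obtain ⟨g', hg', -⟩ := hlift j g 0 fun x => Subsingleton.elim _ _
    exact ⟨g', hg'⟩
  rw [(cogenerates_small E (le_max_right _ _) (le_max_left _ _)).2] at hC
  exact hC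

theorem hasEnoughProjectives_hUnitary :
    HasEnoughProjectives (HUnitary E) (HUnitaryFlat E) (HUnitaryCotorsion E) := by
  intro Z hZ
  obtain ⟨ι, L, K, h₁, h₂, h₃⟩ := exists_test_family E (max #A ℵ₀)
  obtain ⟨F₀, f₀, hf₀, hF₀, hA₀⟩ := hZ.isUnitaryModule.exists_flat_surjection
  have e₀ := Submodule.quotEquivOfEqBot (⊥ : Submodule R F₀) rfl
  -- The extra member `0 ⊆ F₀` forces `f₀` to lift through `p`, which makes `p` surjective.
  let P : Option ι → Σ L : ModuleCat.{u} R, Submodule R L :=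
    fun j => j.elim ⟨F₀, ⊥⟩ fun j => ⟨L j, K j⟩
  obtain ⟨F, i, p, -, -, hflat, hun, hlift⟩ := exists_factorization
    (fun j => (P j).1) (fun j => (P j).2) E
    (by
      rintro (_ | j)
      exacts [(hF₀.of_equiv e₀.symm : EquationallyFlat R (F₀ ⧸ (⊥ : Submodule R F₀))), h₁ j])
    (by
      rintro (_ | j)
      exacts [(hA₀.of_surjective E _ e₀.symm.surjective :
        IsUnitaryModule E (F₀ ⧸ (⊥ : Submodule R F₀))), h₂ j])
    (0 : ModuleCat.of R PUnit.{u + 1} ⟶ Z)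
  have e := Submodule.quotEquivOfEqBot (LinearMap.range i.hom) (by
    rw [eq_bot_iff]
    rintro _ ⟨x, rfl⟩
    rw [Subsingleton.elim x 0, map_zero]
    exact zero_mem _)
  have hF : HUnitaryFlat E F :=
    (hUnitaryFlat_iff E _).2 ⟨hflat.of_equiv e, hun.of_surjective E _ e.surjective⟩
  have hp : Function.Surjective p.hom := by
    intro z
    obtain ⟨x, rfl⟩ := hf₀ z
    have h₀ : ∀ y : (⊥ : Submodule R F₀), p.hom 0 = f₀ y := by
      intro y
      rw [(Submodule.mem_bot R).1 y.2, map_zero, map_zero]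
    obtain ⟨g, -, hg⟩ := hlift none (0 : (⊥ : Submodule R F₀) →ₗ[R] F) f₀ h₀
    exact ⟨g x, hg x⟩
  have w : ModuleCat.ofHom (LinearMap.ker p.hom).subtype ≫ p = 0 :=
    ModuleCat.hom_ext (LinearMap.ext fun y => y.2)
  have hS : (ShortComplex.mk (ModuleCat.ofHom (LinearMap.ker p.hom).subtype) p w).ShortExact := by
    rw [shortExact_iff]
    exact ⟨Submodule.injective_subtype _, fun x hx => ⟨⟨x, hx⟩, rfl⟩, hp⟩
  refine ⟨_, F, _, p, w, ?_, hF, hS⟩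
  -- Lifting over the zero map to `Z` keeps the extension of `g` inside the kernel of `p`.
  have hC := h₃ _ (HUnitary.of_shortExact_left E hS hF.1 hZ) fun j g => by
    obtain ⟨g', hg', hg''⟩ := hlift (some j) ((LinearMap.ker p.hom).subtype ∘ₗ g) 0
      fun x => (g x).2
    exact ⟨g'.codRestrict (LinearMap.ker p.hom) hg'', fun k => Subtype.ext (hg' k)⟩
  rw [(cogenerates_small E (le_max_right _ _) (le_max_left _ _)).2] at hC
  exact hC

/-- For `Z` in `^⊥𝒞` the sequence `0 → C → F → Z → 0` splits, so `Z` is a retract of a flat module.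
-/
theorem isCotorsionPair_hUnitary :
    IsCotorsionPair (HUnitary E) (HUnitaryFlat E) (HUnitaryCotorsion E) := by
  refine ⟨rfl, funext fun Z => propext ⟨fun hZ => ?_, fun hZ => ⟨hZ.1, fun C hC => hC.2 Z hZ⟩⟩⟩
  obtain ⟨C, F, i, p, w, hC, hF, hS⟩ := hasEnoughProjectives_hUnitary E Z hZ.1
  obtain ⟨ρ, hρ⟩ := (relExt1Vanishes_iff E hZ.1 hC.1).1 (hZ.2 C hC) F i p w hS
  have := hS.epi_g
  let s := ShortComplex.Splitting.ofExactOfRetraction _ hS.exact ρ hρ this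
  have hs : s.s ≫ p = 𝟙 Z := s.s_g
  have hflat : EquationallyFlat R Z := EquationallyFlat.of_retract s.s.hom p.hom
    (fun z => congrArg (fun φ => φ.hom z) hs) hF.2.equationallyFlat
  exact ⟨hZ.1, hflat.isFlatModule⟩

end Completeness

theorem mainTheorem3 {A : Type u} [NonUnitalRing A] {R : Type u} [Ring R]
    (E : UnitalExtension A R) :
    IsCompleteCotorsionPair (HUnitary E) (HUnitaryFlat E) (HUnitaryCotorsion E) ∧
    ∀ κ : Cardinal.{u}, ℵ₀ ≤ κ → #A ≤ κ →
      ObjectProperty.EssentiallySmall.{u} (SmallHUnitaryFlat E κ) ∧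
      (∀ F, HUnitaryFlat E F → IsFilteredBy (SmallHUnitaryFlat E κ) F) ∧
      Cogenerates (HUnitary E) (SmallHUnitaryFlat E κ) (HUnitaryFlat E) :=
  ⟨⟨isCotorsionPair_hUnitary E, hasEnoughInjectives_hUnitary E, hasEnoughProjectives_hUnitary E⟩,
    fun κ hκ hA => ⟨SmallHUnitaryFlat.essentiallySmall E κ,
      fun _ hF => isFilteredBy_small E hκ hA hF, cogenerates_small E hκ hA⟩⟩
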